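/- Equip $\mathbb R^3\times L^2([0,1],\mathbb R)$ with its natural real Hilbert space structure. For $a,b\in\mathbb R$ and $q\in L^2([0,1],\mathbb R)$, let $\lambda_n(a,b,q)$, $n=0,1,2,\dots$, denote the eigenvalues in increasing order of the Sturm–Liouville problem $$-u''+qu=\lambda u \text{ on } [0,1],\qquad a\,u(0)+u'(0)=0,\quad b\,u(1)+u'(1)=0.$$ For a full problem $\boldsymbol q=(h_0,h_1,h_2,q)\in\mathbb R^3\times L^2([0,1],\mathbb R)$ put $\boldsymbol q_i=(h_0,h_i,q)$ and $\lambda_{\boldsymbol q_i,n}=\lambda_n(h_0,h_i,q)$ for $i\in\{1,2\}$. **Theorem 2.1.** Let $I\subseteq\{1,2\}\times\{0,1,2,\dots\}$, let $\omega_{i,n}>0$ for $(i,n)\in I$, and assume that $I$ is finite or $\sum_{(i,n)\in I}\omega_{i,n}<\infty$. Let $\boldsymbol Q=(H_0,H_1,H_2,Q)\in\mathbb R^3\times L^2([0,1],\mathbb R)$ be a target problem and define, for $\boldsymbol p\in\mathbb R^3\times L^2([0,1],\mathbb R)$, $$G(\boldsymbol p)=\sum_{(i,n)\in I}\omega_{i,n}\,(\lambda_{\boldsymbol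 p_i,n}-\lambda_{\boldsymbol Q_i,n})^2 .$$ Then this series converges for every $\boldsymbol p$. If $\boldsymbol q=(h_0,h_1,h_2,q)$ satisfies $h_1\ne h_2$, then $G$ is (Fréchet) differentiable at $\boldsymbol q$ and $$\nabla G(\boldsymbol q)=0\iff G(\boldsymbol q)=0 .$$ In particular, if $G(\boldsymbol q)>0$, then $\boldsymbol q$ is not a local minimum of $G$. -/

import Mathlib

open Set MeasureTheory
open scoped Gradient

namespace SturmLiouville

noncomputable section

/-- The space of real square-integrable potentials on `[0,1]`. -/
abbrev Potential : Type := Lp ℝ 2 ((volume : Measure ℝ).restrict (Icc (0 : ℝ) 1))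

/-- The Hilbert space `ℝ³ × L²([0,1], ℝ)` of full problems `(h₀, h₁, h₂, q)`: the first component
is the vector `(h₀, h₁, h₂)` of boundary coefficients, the second one is the potential `q`. -/
abbrev Problem : Type := WithLp 2 (EuclideanSpace ℝ (Fin 3) × Potential)

/-- The coefficient `h₀` of the boundary condition at `0`. -/
def Problem.left (p : Problem) : ℝ := p.fst 0

/-- The coefficients `h₁`, `h₂` of the two boundary conditions at `1`;
the index `0 : Fin 2` stands for `h₁` and `1 : Fin 2` for `h₂`. -/
def Problem.right (p : Problem) (i : Fin 2) : ℝ := p.fst i.succ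

/-- The potential `q`. -/
def Problem.potential (p : Problem) : Potential := p.snd

/-- `u`, with derivative `v`, solves `-u'' + q u = μ u` on `[0,1]`: `u` is differentiable on
`[0,1]` with derivative `v` (one-sided at the endpoints), `v` is absolutely continuous on `[0,1]`,
and the equation holds almost everywhere. -/
structure IsSolution (q : Potential) (μ : ℝ) (u v : ℝ → ℝ) : Prop where
  hasDeriv : ∀ x ∈ Icc (0 : ℝ) 1, HasDerivWithinAt u (v x) (Icc (0 : ℝ) 1) x
  absCont : AbsolutelyContinuousOnInterval v 0 1
  equation : ∀ᵐ x ∂((volume : Measure ℝ).restrict (Icc (0 : ℝ) 1)),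
    -deriv v x + q x * u x = μ * u x

/-- `μ` is an eigenvalue of the problem `(a, b, q)`: there is a nontrivial solution `u` with
`a u(0) + u'(0) = 0` and `b u(1) + u'(1) = 0`. -/
def IsEigenvalue (a b : ℝ) (q : Potential) (μ : ℝ) : Prop :=
  ∃ u v : ℝ → ℝ, IsSolution q μ u v ∧ (∃ x ∈ Icc (0 : ℝ) 1, u x ≠ 0) ∧
    a * u 0 + v 0 = 0 ∧ b * u 1 + v 1 = 0

/-- The `n`-th eigenvalue of `(a, b, q)` in increasing order, counted from `n = 0`: the eigenvalue
with exactly `n` eigenvalues strictly below it. (All eigenvalues are simple, so multiplicities play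
no role. The infimum picks the unique element of the set.) -/
def eigenvalue (a b : ℝ) (q : Potential) (n : ℕ) : ℝ :=
  sInf {μ : ℝ | IsEigenvalue a b q μ ∧ {ν : ℝ | IsEigenvalue a b q ν ∧ ν < μ}.encard = n}

/-- The `n`-th eigenvalue of the `i`-th of the two problems `(h₀, h₁, q)`, `(h₀, h₂, q)`. -/
def Problem.eigenvalue (p : Problem) (i : Fin 2) (n : ℕ) : ℝ :=
  SturmLiouville.eigenvalue p.left (p.right i) p.potential n

/-- The summand of index `k = (i, n)` of the least squares functional for the target `Q`. -/
def residual (ω : Fin 2 × ℕ → ℝ) (Q p : Problem) (k : Fin 2 × ℕ) : ℝ :=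
  ω k * (Problem.eigenvalue p k.1 k.2 - Problem.eigenvalue Q k.1 k.2) ^ 2

/-- The weighted least squares functional
`G(p) = ∑_{(i,n) ∈ I} ω_{i,n} (λ_{p,i,n} - λ_{Q,i,n})²`. -/
def G (I : Set (Fin 2 × ℕ)) (ω : Fin 2 × ℕ → ℝ) (Q p : Problem) : ℝ :=
  ∑' k : I, residual ω Q p k

end

end SturmLiouville

/-!
The functional is differentiable because every eigenvalue is, with derivatives bounded uniformly in
the index, and its critical points are its zeros because the derivatives of the eigenvalues of the
two subproblems form one half of a biorthogonal system as soon as `h₁ ≠ h₂`.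

*Solutions.* The equation `u'' = (q - μ) u` with `q ∈ L²` is solved by inverting `1 - K`, where `K`
is a quasinilpotent Volterra operator on pairs of continuous functions (`isUnit_one_sub_step`); the
solution depends continuously on the data (`continuous_ivp`). The eigenvalues of `(a, b, q)` are the
zeros in `μ` of `charFn`, the boundary form at `1` of the solution with `u(0) = 1`, `u'(0) = -a`.

*Eigenvalues.* Integrating the Wronskian of the solutions of two problems gives the exact identity
`charFn_identity`. It shows that all zeros are simple sign changes and that nearby problems have
exactly one eigenvalue near each given one (`exists_isolating_nhds`). Together with a locally
uniform lower bound (`eigenvalue_lower_bound`), the number of eigenvalues below a non-eigenvalue is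
locally constant, so each `λₙ` is continuous (`continuous_nthEigenvalue`). There are infinitely many
eigenvalues since `charFn` alternates in sign along `μ = k²`, `cos k = 0`, `k` large
(`sin_mul_charFn_neg`). Given continuity, the same identity, divided by `∫ u ũ`, is a
difference quotient whose limit is the derivative of `λₙ` (`hasFDerivAt_nthEigenvalue`).

*Uniform bounds.* The derivative of `λₙ` is bounded by `sup u² / ∫ u²`. For eigenvalues in a bounded
range this ratio is controlled by interpolation between `∫ u²` and `∫ u'²`, and for large
eigenvalues `k²` by the near constancy of the energy `u'² + k² u²` (`energy_le`), so it is bounded uniformly in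
`n` on bounded sets of problems (`sq_norm_leftSol_le`). By the mean value inequality so is
`λₙ(p) - λₙ(Q)`, and the series can be differentiated term by term.

*Biorthogonality.* For a solution `g` at `ν` and solutions `u`, `y` at `μ ≠ ν`, the integral
`∫ g² (u y)'` is given by boundary values of `g² u y` and of the product of the Wronskians of `g`
with `u` and `y`. If `u` is an eigenfunction of one subproblem and `y` satisfies the boundary
condition at `1` of the other one, the latter product vanishes at both endpoints for every other eigenfunction
`g` of either subproblem (`exists_biorthogonal`). Pairing the derivative of `G` with the
vector with potential `(u y)'` therefore isolates a single residual.
-/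

namespace SturmLiouville

/-! ### Absolutely continuous functions on the unit interval -/

/-- `f` is absolutely continuous on `[0,1]` with derivative `f'` almost everywhere, encoded by the
fundamental theorem of calculus: `f` is the primitive of the integrable function `f'`. -/
structure HasWeakDeriv (f f' : ℝ → ℝ) : Prop where
  integrable : IntervalIntegrable f' volume 0 1
  eq_integral : ∀ x ∈ Icc (0 : ℝ) 1, f x = f 0 + ∫ t in (0 : ℝ)..x, f' t

namespace HasWeakDeriv

variable {f f' g g' : ℝ → ℝ}

lemma integrable_sub (hf : HasWeakDeriv f f') {x y : ℝ} (hx : x ∈ Icc (0 : ℝ) 1)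
    (hy : y ∈ Icc (0 : ℝ) 1) : IntervalIntegrable f' volume x y := by
  refine hf.integrable.mono_set ?_
  rw [uIcc_of_le zero_le_one]
  exact uIcc_subset_Icc hx hy

lemma sub_eq (hf : HasWeakDeriv f f') {x y : ℝ} (hx : x ∈ Icc (0 : ℝ) 1)
    (hy : y ∈ Icc (0 : ℝ) 1) : f y - f x = ∫ t in x..y, f' t := by
  have h0 : (0 : ℝ) ∈ Icc (0 : ℝ) 1 := by simp
  rw [hf.eq_integral x hx, hf.eq_integral y hy,
    ← intervalIntegral.integral_add_adjacent_intervals (hf.integrable_sub h0 hx)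
      (hf.integrable_sub hx hy)]
  ring

lemma absolutelyContinuous_primitive (hf : HasWeakDeriv f f') :
    AbsolutelyContinuousOnInterval (fun x => f 0 + ∫ t in (0 : ℝ)..x, f' t) 0 1 := by
  have h1 := hf.integrable.absolutelyContinuousOnInterval_intervalIntegral (c := 0) (by simp)
  have h2 : AbsolutelyContinuousOnInterval (fun _ : ℝ => f 0) 0 1 :=
    contDiffOn_const.absolutelyContinuousOnInterval
  exact h2.add h1

lemma absolutelyContinuous (hf : HasWeakDeriv f f') : AbsolutelyContinuousOnInterval f 0 1 := by
  have h := hf.absolutelyContinuous_primitive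
  rw [absolutelyContinuousOnInterval_iff] at h ⊢
  intro ε hε
  obtain ⟨δ, hδ, H⟩ := h ε hε
  refine ⟨δ, hδ, fun E hE hlt => ?_⟩
  convert! H E hE hlt using 1
  refine Finset.sum_congr rfl fun i hi => ?_
  have := hE.1 i hi
  rw [uIcc_of_le zero_le_one] at this
  rw [hf.eq_integral _ this.1, hf.eq_integral _ this.2]

lemma continuousOn (hf : HasWeakDeriv f f') : ContinuousOn f (Icc 0 1) := by
  have := hf.absolutelyContinuous.continuousOn
  rwa [uIcc_of_le zero_le_one] at this

lemma of_absolutelyContinuous (hf : AbsolutelyContinuousOnInterval f 0 1) :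
    HasWeakDeriv f (deriv f) := by
  refine ⟨hf.intervalIntegrable_deriv, fun x hx => ?_⟩
  have : AbsolutelyContinuousOnInterval f 0 x := hf.mono (by
    rw [uIcc_of_le zero_le_one, uIcc_of_le hx.1]; exact Icc_subset_Icc le_rfl hx.2)
  rw [this.integral_deriv_eq_sub]; ring

lemma congr_ae (hf : HasWeakDeriv f f')
    (h : ∀ᵐ x ∂((volume : Measure ℝ).restrict (Icc (0 : ℝ) 1)), f' x = g' x) :
    HasWeakDeriv f g' := by
  have h' : ∀ᵐ x ∂((volume : Measure ℝ).restrict (Ioc (0 : ℝ) 1)), f' x = g' x :=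
    ae_restrict_of_ae_restrict_of_subset Ioc_subset_Icc_self h
  refine ⟨hf.integrable.congr_ae (by rwa [uIoc_of_le zero_le_one]), fun x hx => ?_⟩
  rw [hf.eq_integral x hx]
  congr 1
  refine intervalIntegral.integral_congr_ae_restrict ?_
  rw [uIoc_of_le hx.1]
  exact ae_restrict_of_ae_restrict_of_subset (Ioc_subset_Icc_self.trans
    (Icc_subset_Icc le_rfl hx.2)) h

lemma congr (hf : HasWeakDeriv f f') (h : ∀ x ∈ Icc (0 : ℝ) 1, f' x = g' x) :
    HasWeakDeriv f g' :=
  hf.congr_ae ((ae_restrict_iff' measurableSet_Icc).2 (Filter.Eventually.of_forall h))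

lemma of_hasDerivAt (h : ∀ x, HasDerivAt f (f' x) x) (hc : Continuous f') :
    HasWeakDeriv f f' := by
  refine ⟨hc.intervalIntegrable _ _, fun x _ => ?_⟩
  rw [intervalIntegral.integral_eq_sub_of_hasDerivAt (fun y _ => h y) (hc.intervalIntegrable _ _)]
  ring

lemma of_hasDerivWithinAt (h : ∀ x ∈ Icc (0 : ℝ) 1, HasDerivWithinAt f (f' x) (Icc 0 1) x)
    (hc : ContinuousOn f' (Icc 0 1)) : HasWeakDeriv f f' := by
  have hi : ∀ x ∈ Icc (0 : ℝ) 1, IntervalIntegrable f' volume 0 x := fun x hx => by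
    refine (hc.mono ?_).intervalIntegrable
    rw [uIcc_of_le hx.1]
    exact Icc_subset_Icc le_rfl hx.2
  refine ⟨hi 1 (by simp), fun x hx => ?_⟩
  rw [intervalIntegral.integral_eq_sub_of_hasDerivAt_of_le hx.1
    (fun y hy => (h y ⟨hy.1, hy.2.trans hx.2⟩).continuousWithinAt.mono
      (Icc_subset_Icc le_rfl hx.2))
    (fun y hy => (h y ⟨hy.1.le, hy.2.le.trans hx.2⟩).hasDerivAt
      (Icc_mem_nhds hy.1 (hy.2.trans_le hx.2))) (hi x hx)]
  ring

lemma hasDerivWithinAt (hf : HasWeakDeriv f f') (hc : ContinuousOn f' (Icc 0 1)) {x : ℝ}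
    (hx : x ∈ Icc (0 : ℝ) 1) : HasDerivWithinAt f (f' x) (Icc 0 1) x := by
  have h0 : (0 : ℝ) ∈ Icc (0 : ℝ) 1 := by simp
  have : Fact (x ∈ Icc (0 : ℝ) 1) := ⟨hx⟩
  have h := intervalIntegral.integral_hasDerivWithinAt_right (hf.integrable_sub h0 hx)
    (s := Icc 0 1) (t := Icc 0 1)
    (hc.stronglyMeasurableAtFilter_nhdsWithin measurableSet_Icc x) (hc x hx)
  exact (h.const_add (f 0)).congr (fun y hy => hf.eq_integral y hy) (hf.eq_integral x hx)

lemma ae_deriv_eq (hf : HasWeakDeriv f f') :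
    ∀ᵐ x ∂((volume : Measure ℝ).restrict (Icc (0 : ℝ) 1)), deriv f x = f' x := by
  rw [ae_restrict_iff' measurableSet_Icc]
  have h0 : ∀ᵐ x : ℝ, x ≠ 0 := by simp [ae_iff, measure_singleton]
  have h1 : ∀ᵐ x : ℝ, x ≠ 1 := by simp [ae_iff, measure_singleton]
  filter_upwards [hf.integrable.ae_hasDerivAt_integral, h0, h1] with x hx hx0 hx1 hxI
  have hd := (hx (by rwa [uIcc_of_le zero_le_one]) 0 (by simp)).const_add (f 0)
  have hxo : Icc (0 : ℝ) 1 ∈ nhds x :=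
    Icc_mem_nhds (lt_of_le_of_ne hxI.1 (Ne.symm hx0)) (lt_of_le_of_ne hxI.2 hx1)
  refine (hd.congr_of_eventuallyEq ?_).deriv
  filter_upwards [hxo] with y hy using hf.eq_integral y hy

lemma const_mul (c : ℝ) (hf : HasWeakDeriv f f') :
    HasWeakDeriv (fun x => c * f x) (fun x => c * f' x) := by
  refine ⟨hf.integrable.const_mul c, fun x hx => ?_⟩
  rw [intervalIntegral.integral_const_mul, hf.eq_integral x hx]
  ring

lemma add (hf : HasWeakDeriv f f') (hg : HasWeakDeriv g g') :
    HasWeakDeriv (fun x => f x + g x) (fun x => f' x + g' x) := by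
  have h0 : (0 : ℝ) ∈ Icc (0 : ℝ) 1 := by simp
  refine ⟨hf.integrable.add hg.integrable, fun x hx => ?_⟩
  rw [intervalIntegral.integral_add (hf.integrable_sub h0 hx) (hg.integrable_sub h0 hx),
    hf.eq_integral x hx, hg.eq_integral x hx]
  ring

lemma sub (hf : HasWeakDeriv f f') (hg : HasWeakDeriv g g') :
    HasWeakDeriv (fun x => f x - g x) (fun x => f' x - g' x) := by
  have h0 : (0 : ℝ) ∈ Icc (0 : ℝ) 1 := by simp
  refine ⟨hf.integrable.sub hg.integrable, fun x hx => ?_⟩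
  rw [intervalIntegral.integral_sub (hf.integrable_sub h0 hx) (hg.integrable_sub h0 hx),
    hf.eq_integral x hx, hg.eq_integral x hx]
  ring

/-- The product rule. -/
lemma mul (hf : HasWeakDeriv f f') (hg : HasWeakDeriv g g') :
    HasWeakDeriv (fun x => f x * g x) (fun x => f' x * g x + f x * g' x) := by
  have h := of_absolutelyContinuous (hf.absolutelyContinuous.fun_mul hg.absolutelyContinuous)
  refine h.congr_ae ?_
  have h0 : ∀ᵐ x ∂((volume : Measure ℝ).restrict (Icc (0 : ℝ) 1)), x ≠ 0 :=
    ae_restrict_of_ae (by simp [ae_iff, measure_singleton])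
  have h1 : ∀ᵐ x ∂((volume : Measure ℝ).restrict (Icc (0 : ℝ) 1)), x ≠ 1 :=
    ae_restrict_of_ae (by simp [ae_iff, measure_singleton])
  have hf2 := ae_restrict_of_ae (s := Icc (0 : ℝ) 1) hf.absolutelyContinuous.ae_differentiableAt
  have hg2 := ae_restrict_of_ae (s := Icc (0 : ℝ) 1) hg.absolutelyContinuous.ae_differentiableAt
  filter_upwards [hf.ae_deriv_eq, hg.ae_deriv_eq, hf2, hg2, ae_restrict_mem measurableSet_Icc]
    with x hfx hgx hfd hgd hx
  rw [uIcc_of_le zero_le_one] at hfd hgd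
  rw [← hfx, ← hgx]
  exact deriv_fun_mul (hfd hx) (hgd hx)

lemma integral_eq (hf : HasWeakDeriv f f') : ∫ t in (0 : ℝ)..1, f' t = f 1 - f 0 :=
  (hf.sub_eq (by simp) (by simp)).symm

end HasWeakDeriv

/-- The pair `(u, v)` solves `u' = v`, `v' = w u` on `[0,1]`; equivalently `u'' = w u`. -/
structure IsPair (w u v : ℝ → ℝ) : Prop where
  fst : HasWeakDeriv u v
  snd : HasWeakDeriv v (fun t => w t * u t)

namespace IsPair

variable {w w₁ w₂ u u₁ u₂ v v₁ v₂ : ℝ → ℝ}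

/-- The derivative of the Wronskian of solutions of `u₁'' = w₁ u₁` and `u₂'' = w₂ u₂`. -/
lemma wronskian (h₁ : IsPair w₁ u₁ v₁) (h₂ : IsPair w₂ u₂ v₂) :
    HasWeakDeriv (fun x => u₁ x * v₂ x - v₁ x * u₂ x)
      (fun x => (w₂ x - w₁ x) * (u₁ x * u₂ x)) := by
  refine ((h₁.fst.mul h₂.snd).sub (h₁.snd.mul h₂.fst)).congr fun x _ => ?_
  ring

lemma linear_comb (h₁ : IsPair w u₁ v₁) (h₂ : IsPair w u₂ v₂) (α β : ℝ) :
    IsPair w (fun x => α * u₁ x + β * u₂ x) (fun x => α * v₁ x + β * v₂ x) := by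
  refine ⟨(h₁.fst.const_mul α).add (h₂.fst.const_mul β), ?_⟩
  refine ((h₁.snd.const_mul α).add (h₂.snd.const_mul β)).congr fun x _ => ?_
  ring

end IsPair

end SturmLiouville

namespace SturmLiouville

/-! ### The initial value problem -/

noncomputable section

/-- The space of continuous functions on `[0,1]`. -/
abbrev Cont : Type := C(Icc (0 : ℝ) 1, ℝ)

/-- The extension of a continuous function on `[0,1]` to `ℝ` by its boundary values. -/
abbrev Cont.ext (f : Cont) : ℝ → ℝ := IccExtend (zero_le_one' ℝ) f

lemma Cont.continuous_ext (f : Cont) : Continuous f.ext := f.continuous.Icc_extend'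

lemma Cont.ext_apply (f : Cont) {x : ℝ} (hx : x ∈ Icc (0 : ℝ) 1) : f.ext x = f ⟨x, hx⟩ :=
  IccExtend_of_mem _ _ hx

lemma Cont.abs_ext_le (f : Cont) (x : ℝ) : |f.ext x| ≤ ‖f‖ :=
  f.norm_coe_le_norm _

lemma Potential.intervalIntegrable (w : Potential) : IntervalIntegrable w volume 0 1 := by
  rw [intervalIntegrable_iff_integrableOn_Icc_of_le zero_le_one]
  exact (Lp.memLp w).integrable (by norm_num)

lemma Potential.intervalIntegrable_mul (w : Potential) {f : ℝ → ℝ} (hf : Continuous f) {x y : ℝ}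
    (hx : x ∈ Icc (0 : ℝ) 1) (hy : y ∈ Icc (0 : ℝ) 1) :
    IntervalIntegrable (fun t => w t * f t) volume x y := by
  refine (w.intervalIntegrable.mul_continuousOn hf.continuousOn).mono_set ?_
  rw [uIcc_of_le zero_le_one]
  exact uIcc_subset_Icc hx hy

/-- The Cauchy-Schwarz inequality on the interval `[0,x]`. -/
lemma Potential.sq_integral_mul_le (w : Potential) {f : ℝ → ℝ} (hf : Continuous f) {x : ℝ}
    (hx : x ∈ Icc (0 : ℝ) 1) :
    (∫ t in (0 : ℝ)..x, w t * f t) ^ 2 ≤ ‖w‖ ^ 2 * ∫ t in (0 : ℝ)..x, f t ^ 2 := by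
  have hsub : Ioc 0 x ⊆ Icc (0 : ℝ) 1 :=
    Ioc_subset_Icc_self.trans (Icc_subset_Icc le_rfl hx.2)
  have hbdd : ∃ C, ∀ t ∈ Icc (0 : ℝ) 1, ‖f t‖ ≤ C :=
    isCompact_Icc.exists_bound_of_continuousOn hf.continuousOn
  obtain ⟨C, hC⟩ := hbdd
  have hF : MemLp ((Ioc 0 x).indicator f) 2 ((volume : Measure ℝ).restrict (Icc (0 : ℝ) 1)) := by
    refine MemLp.of_bound (hf.aestronglyMeasurable.indicator measurableSet_Ioc) C ?_
    rw [ae_restrict_iff' measurableSet_Icc]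
    exact Filter.Eventually.of_forall fun t ht => (norm_indicator_le_norm_self _ _).trans (hC t ht)
  set F := hF.toLp with hFdef
  have hFae : F =ᵐ[(volume : Measure ℝ).restrict (Icc (0 : ℝ) 1)] (Ioc 0 x).indicator f :=
    hF.coeFn_toLp
  have h1 : inner ℝ F w = ∫ t in (0 : ℝ)..x, w t * f t := by
    rw [L2.inner_def, intervalIntegral.integral_of_le hx.1,
      ← inter_eq_left.2 hsub, ← Measure.restrict_restrict measurableSet_Ioc,
      ← integral_indicator measurableSet_Ioc]
    refine integral_congr_ae ?_
    filter_upwards [hFae] with t ht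
    rw [ht]
    by_cases h : t ∈ Ioc 0 x <;> simp [h]
  have h2 : ‖F‖ ^ 2 = ∫ t in (0 : ℝ)..x, f t ^ 2 := by
    rw [← real_inner_self_eq_norm_sq, L2.inner_def, intervalIntegral.integral_of_le hx.1,
      ← inter_eq_left.2 hsub, ← Measure.restrict_restrict measurableSet_Ioc,
      ← integral_indicator measurableSet_Ioc]
    refine integral_congr_ae ?_
    filter_upwards [hFae] with t ht
    rw [ht]
    by_cases h : t ∈ Ioc 0 x <;> simp [h, sq]
  rw [← h1, ← h2, mul_comm, ← mul_pow, ← sq_abs]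
  exact pow_le_pow_left₀ (abs_nonneg _) (abs_real_inner_le_norm F w) 2

/-- The primitive `x ↦ ∫₀ˣ w f`, vanishing at `0`, of the product of `w ∈ L²` and `f`. -/
def primitiveMul (w : Potential) (f : Cont) : Cont where
  toFun x := ∫ t in (0 : ℝ)..x, w t * f.ext t
  continuous_toFun := by
    have h := intervalIntegral.continuousOn_primitive_interval'
      (w.intervalIntegrable_mul f.continuous_ext (x := 0) (y := 1) (by simp) (by simp))
      left_mem_uIcc
    rw [uIcc_of_le zero_le_one] at h
    exact continuousOn_iff_continuous_domRestrict.1 h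

lemma primitiveMul_apply (w : Potential) (f : Cont) (x : Icc (0 : ℝ) 1) :
    primitiveMul w f x = ∫ t in (0 : ℝ)..x, w t * f.ext t := rfl

lemma norm_primitiveMul_le (w : Potential) (f : Cont) : ‖primitiveMul w f‖ ≤ 1 * ‖w‖ * ‖f‖ := by
  rw [one_mul, ContinuousMap.norm_le _ (by positivity)]
  intro x
  rw [Real.norm_eq_abs]
  refine abs_le_of_sq_le_sq ?_ (by positivity)
  refine (w.sq_integral_mul_le f.continuous_ext x.2).trans ?_
  rw [mul_pow]
  refine mul_le_mul_of_nonneg_left ?_ (by positivity)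
  calc ∫ t in (0 : ℝ)..x, f.ext t ^ 2 ≤ ∫ t in (0 : ℝ)..x, ‖f‖ ^ 2 := by
        refine intervalIntegral.integral_mono_on x.2.1
          ((f.continuous_ext.pow 2).intervalIntegrable _ _) (by simp) fun t _ => ?_
        exact sq_le_sq' (neg_le_of_abs_le (f.abs_ext_le t)) (le_of_abs_le (f.abs_ext_le t))
    _ = x * ‖f‖ ^ 2 := by simp
    _ ≤ ‖f‖ ^ 2 := mul_le_of_le_one_left (by positivity) x.2.2

/-- The bounded bilinear map `(w, f) ↦ ∫₀ˣ w f`. -/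
def volterra : Potential →L[ℝ] Cont →L[ℝ] Cont :=
  LinearMap.mkContinuous₂
    (LinearMap.mk₂ ℝ primitiveMul
      (fun w w' f => by
        ext x
        have h0 : (0 : ℝ) ∈ Icc (0 : ℝ) 1 := by simp
        simp only [ContinuousMap.add_apply, primitiveMul_apply]
        rw [← intervalIntegral.integral_add (w.intervalIntegrable_mul f.continuous_ext h0 x.2)
          (w'.intervalIntegrable_mul f.continuous_ext h0 x.2)]
        refine intervalIntegral.integral_congr_ae_restrict ?_
        rw [uIoc_of_le x.2.1]
        have := Lp.coeFn_add w w'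
        filter_upwards [ae_restrict_of_ae_restrict_of_subset (Ioc_subset_Icc_self.trans
          (Icc_subset_Icc le_rfl x.2.2)) this] with t ht
        rw [ht, Pi.add_apply, add_mul])
      (fun c w f => by
        ext x
        simp only [ContinuousMap.smul_apply, primitiveMul_apply, smul_eq_mul]
        rw [← intervalIntegral.integral_const_mul]
        refine intervalIntegral.integral_congr_ae_restrict ?_
        rw [uIoc_of_le x.2.1]
        have := Lp.coeFn_smul c w
        filter_upwards [ae_restrict_of_ae_restrict_of_subset (Ioc_subset_Icc_self.trans
          (Icc_subset_Icc le_rfl x.2.2)) this] with t ht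
        rw [ht, Pi.smul_apply, smul_eq_mul, mul_assoc])
      (fun w f g => by
        ext x
        have h0 : (0 : ℝ) ∈ Icc (0 : ℝ) 1 := by simp
        simp only [ContinuousMap.add_apply, primitiveMul_apply]
        rw [← intervalIntegral.integral_add (w.intervalIntegrable_mul f.continuous_ext h0 x.2)
          (w.intervalIntegrable_mul g.continuous_ext h0 x.2)]
        refine intervalIntegral.integral_congr fun t _ => ?_
        simp only [Cont.ext, IccExtend, Function.comp_apply, ContinuousMap.add_apply]
        ring)
      (fun c w f => by
        ext x
        simp only [ContinuousMap.smul_apply, primitiveMul_apply, smul_eq_mul]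
        rw [← intervalIntegral.integral_const_mul]
        refine intervalIntegral.integral_congr fun t _ => ?_
        simp only [Cont.ext, IccExtend, Function.comp_apply, ContinuousMap.smul_apply,
          smul_eq_mul]
        ring))
    1 norm_primitiveMul_le

lemma volterra_apply (w : Potential) (f : Cont) (x : Icc (0 : ℝ) 1) :
    volterra w f x = ∫ t in (0 : ℝ)..x, w t * f.ext t := rfl

lemma sq_volterra_le (w : Potential) (f : Cont) (x : Icc (0 : ℝ) 1) :
    (volterra w f x) ^ 2 ≤ ‖w‖ ^ 2 * ∫ t in (0 : ℝ)..x, f.ext t ^ 2 :=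
  w.sq_integral_mul_le f.continuous_ext x.2

/-- The constant potential `1`. -/
def onePotential : Potential := Lp.const 2 _ (1 : ℝ)

lemma coeFn_onePotential :
    (onePotential : ℝ → ℝ) =ᵐ[(volume : Measure ℝ).restrict (Icc (0 : ℝ) 1)] fun _ => 1 :=
  Lp.coeFn_const ..

lemma volterra_one_apply (f : Cont) (x : Icc (0 : ℝ) 1) :
    volterra onePotential f x = ∫ t in (0 : ℝ)..x, f.ext t := by
  rw [volterra_apply]
  refine intervalIntegral.integral_congr_ae_restrict ?_
  rw [uIoc_of_le x.2.1]
  filter_upwards [ae_restrict_of_ae_restrict_of_subset (Ioc_subset_Icc_self.trans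
    (Icc_subset_Icc le_rfl x.2.2)) coeFn_onePotential] with t ht
  rw [ht, one_mul]

/-- The Volterra operator `K : (u, v) ↦ (∫₀ˣ v, ∫₀ˣ w u)`: a pair `z` solves `u' = v`, `v' = w u`
if and only if `z - K z` is constant. -/
def step (w : Potential) : (Cont × Cont) →L[ℝ] (Cont × Cont) :=
  ((volterra onePotential).comp (ContinuousLinearMap.snd ℝ Cont Cont)).prod
    ((volterra w).comp (ContinuousLinearMap.fst ℝ Cont Cont))

lemma step_apply (w : Potential) (z : Cont × Cont) :
    step w z = (volterra onePotential z.2, volterra w z.1) := rfl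

lemma continuous_step : Continuous step := by
  have h : step = fun w =>
      ((ContinuousLinearMap.inl ℝ Cont Cont).comp
        ((volterra onePotential).comp (ContinuousLinearMap.snd ℝ Cont Cont))) +
      ((ContinuousLinearMap.inr ℝ Cont Cont).comp
        ((volterra w).comp (ContinuousLinearMap.fst ℝ Cont Cont))) := by
    funext w
    ext z <;> simp [step_apply]
  rw [h]
  exact continuous_const.add (continuous_const.clm_comp
    ((volterra.continuous).clm_comp continuous_const))

lemma integral_sq_le_of_sq_le {f : ℝ → ℝ} (hf : Continuous f) {B : ℝ} {n : ℕ} {x : ℝ}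
    (hx : x ∈ Icc (0 : ℝ) 1)
    (h : ∀ t ∈ Icc (0 : ℝ) 1, f t ^ 2 ≤ B * (t ^ n / n.factorial)) :
    ∫ t in (0 : ℝ)..x, f t ^ 2 ≤ B * (x ^ (n + 1) / (n + 1).factorial) := by
  calc ∫ t in (0 : ℝ)..x, f t ^ 2 ≤ ∫ t in (0 : ℝ)..x, B * (t ^ n / n.factorial) := by
        refine intervalIntegral.integral_mono_on hx.1
          ((hf.pow 2).intervalIntegrable _ _)
          (Continuous.intervalIntegrable (by fun_prop) _ _) fun t ht => ?_
        exact h t ⟨ht.1, ht.2.trans hx.2⟩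
    _ = B * (x ^ (n + 1) / (n + 1).factorial) := by
        rw [intervalIntegral.integral_const_mul, intervalIntegral.integral_div, integral_pow,
          Nat.factorial_succ]
        push_cast
        rw [zero_pow (Nat.succ_ne_zero n), sub_zero, div_div]

lemma sq_step_pow_le (w : Potential) (z : Cont × Cont) (n : ℕ) (x : Icc (0 : ℝ) 1) :
    (((step w) ^ n) z).1 x ^ 2 ≤
        (‖onePotential‖ ^ 2 + ‖w‖ ^ 2) ^ n * ‖z‖ ^ 2 * ((x : ℝ) ^ n / n.factorial) ∧
      (((step w) ^ n) z).2 x ^ 2 ≤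
        (‖onePotential‖ ^ 2 + ‖w‖ ^ 2) ^ n * ‖z‖ ^ 2 * ((x : ℝ) ^ n / n.factorial) := by
  induction n generalizing x with
  | zero =>
    have h1 : |z.1 x| ≤ ‖z‖ := (z.1.norm_coe_le_norm x).trans (norm_fst_le z)
    have h2 : |z.2 x| ≤ ‖z‖ := (z.2.norm_coe_le_norm x).trans (norm_snd_le z)
    simp only [pow_zero, one_apply_eq_self, one_mul, Nat.factorial_zero, Nat.cast_one,
      div_one, mul_one]
    exact ⟨sq_le_sq' (neg_le_of_abs_le h1) (le_of_abs_le h1),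
      sq_le_sq' (neg_le_of_abs_le h2) (le_of_abs_le h2)⟩
  | succ n ih =>
    set M := ‖onePotential‖ ^ 2 + ‖w‖ ^ 2 with hM
    have hM1 : ‖onePotential‖ ^ 2 ≤ M := by rw [hM]; nlinarith [sq_nonneg ‖w‖]
    have hM2 : ‖w‖ ^ 2 ≤ M := by rw [hM]; nlinarith [sq_nonneg ‖onePotential‖]
    have hM0 : 0 ≤ M := by positivity
    rw [pow_succ' (step w), mul_apply_eq_comp]
    set y := ((step w) ^ n) z
    have key : ∀ (p : Potential) (f : Cont), ‖p‖ ^ 2 ≤ M →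
        (∀ t, f t ^ 2 ≤ M ^ n * ‖z‖ ^ 2 * ((t : ℝ) ^ n / n.factorial)) →
        (volterra p f x) ^ 2 ≤
          M ^ (n + 1) * ‖z‖ ^ 2 * ((x : ℝ) ^ (n + 1) / (n + 1).factorial) := by
      intro p f hp hf
      have hx0 : (0 : ℝ) ≤ x := x.2.1
      refine (sq_volterra_le p f x).trans ?_
      have h1 := integral_sq_le_of_sq_le f.continuous_ext x.2 (B := M ^ n * ‖z‖ ^ 2) (n := n)
        fun t ht => by rw [Cont.ext_apply _ ht]; exact hf ⟨t, ht⟩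
      refine (mul_le_mul hp h1 (intervalIntegral.integral_nonneg hx0 fun t _ => sq_nonneg _)
        hM0).trans (le_of_eq ?_)
      ring
    exact ⟨key _ _ hM1 fun t => (ih t).2, key _ _ hM2 fun t => (ih t).1⟩

lemma norm_step_pow_le (w : Potential) (n : ℕ) :
    ‖(step w) ^ n‖ ≤ √((‖onePotential‖ ^ 2 + ‖w‖ ^ 2) ^ n / n.factorial) := by
  set M := ‖onePotential‖ ^ 2 + ‖w‖ ^ 2 with hM
  refine ContinuousLinearMap.opNorm_le_bound _ (Real.sqrt_nonneg _) fun z => ?_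
  have key : ∀ x : Icc (0 : ℝ) 1, M ^ n * ‖z‖ ^ 2 * ((x : ℝ) ^ n / n.factorial) ≤
      (√(M ^ n / n.factorial) * ‖z‖) ^ 2 := by
    intro x
    rw [mul_pow, Real.sq_sqrt (by positivity)]
    have : (x : ℝ) ^ n ≤ 1 := pow_le_one₀ x.2.1 x.2.2
    calc M ^ n * ‖z‖ ^ 2 * ((x : ℝ) ^ n / n.factorial)
        = M ^ n / n.factorial * ‖z‖ ^ 2 * (x : ℝ) ^ n := by ring
      _ ≤ M ^ n / n.factorial * ‖z‖ ^ 2 := mul_le_of_le_one_right (by positivity) this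
  rw [Prod.norm_def]
  refine max_le ?_ ?_ <;> rw [ContinuousMap.norm_le _ (by positivity)] <;> intro x <;>
    rw [Real.norm_eq_abs] <;> refine abs_le_of_sq_le_sq ?_ (by positivity)
  · exact (sq_step_pow_le w z n x).1.trans (key x)
  · exact (sq_step_pow_le w z n x).2.trans (key x)

/-- The Volterra operator is quasinilpotent, so the initial value problem is uniquely solvable. -/
lemma isUnit_one_sub_step (w : Potential) : IsUnit (1 - step w) := by
  obtain ⟨n, hn⟩ := ((FloorSemiring.tendsto_pow_div_factorial_atTop
    (‖onePotential‖ ^ 2 + ‖w‖ ^ 2)).eventually_lt_const one_pos).exists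
  have h1 : ‖(step w) ^ n‖ < 1 := by
    refine (norm_step_pow_le w n).trans_lt ?_
    rw [Real.sqrt_lt' one_pos]
    simpa using hn
  have h2 := isUnit_one_sub_of_norm_lt_one (R := (Cont × Cont) →L[ℝ] (Cont × Cont)) h1
  have hc : Commute (1 - step w) (∑ i ∈ Finset.range n, (step w) ^ i) :=
    Commute.sum_right _ _ _ fun i _ =>
      (Commute.one_left _).sub_left ((Commute.refl (step w)).pow_right i)
  rw [← mul_neg_geom_sum, hc.isUnit_mul_iff] at h2
  exact h2.1

/-- The solution `(u, u')` of `u'' = w u` with `u(0) = c.1` and `u'(0) = c.2`. -/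
def ivp (w : Potential) (c : ℝ × ℝ) : Cont × Cont :=
  Ring.inverse (1 - step w) (ContinuousMap.const _ c.1, ContinuousMap.const _ c.2)

lemma continuous_ivp : Continuous fun p : Potential × (ℝ × ℝ) => ivp p.1 p.2 := by
  have h1 : Continuous fun w : Potential => Ring.inverse (1 - step w) := by
    rw [continuous_iff_continuousAt]
    intro w
    obtain ⟨y, hy⟩ := isUnit_one_sub_step w
    have := NormedRing.inverse_continuousAt (R := (Cont × Cont) →L[ℝ] (Cont × Cont)) y
    rw [hy] at this
    exact this.comp (f := fun w => 1 - step w)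
      (continuous_const.sub continuous_step).continuousAt
  refine (h1.comp continuous_fst).clm_apply ?_
  have h2 : Continuous fun c : ℝ => (ContinuousMap.const (Icc (0 : ℝ) 1) c) :=
    ContinuousMap.continuous_const'
  exact (h2.comp (continuous_fst.comp continuous_snd)).prodMk
    (h2.comp (continuous_snd.comp continuous_snd))

lemma ivp_sub_step (w : Potential) (c : ℝ × ℝ) :
    ivp w c - step w (ivp w c) =
      (ContinuousMap.const _ c.1, ContinuousMap.const _ c.2) := by
  have h := Ring.mul_inverse_cancel _ (isUnit_one_sub_step w)
  have h2 := congrArg (fun T : (Cont × Cont) →L[ℝ] (Cont × Cont) =>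
    T (ContinuousMap.const _ c.1, ContinuousMap.const _ c.2)) h
  simpa [ivp] using h2

lemma eq_ivp_of_sub_step (w : Potential) (c : ℝ × ℝ) (z : Cont × Cont)
    (hz : z - step w z = (ContinuousMap.const _ c.1, ContinuousMap.const _ c.2)) :
    z = ivp w c := by
  have h := Ring.inverse_mul_cancel _ (isUnit_one_sub_step w)
  have h2 := congrArg (fun T : (Cont × Cont) →L[ℝ] (Cont × Cont) => T z) h
  simp only [mul_apply_eq_comp, _root_.sub_apply,
    one_apply_eq_self] at h2
  rw [ivp, ← hz, h2]

lemma ivp_fst_ext (w : Potential) (c : ℝ × ℝ) {x : ℝ} (hx : x ∈ Icc (0 : ℝ) 1) :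
    (ivp w c).1.ext x = c.1 + ∫ t in (0 : ℝ)..x, (ivp w c).2.ext t := by
  have h := congrArg (fun z : Cont × Cont => z.1 ⟨x, hx⟩) (ivp_sub_step w c)
  simp only [step_apply, Prod.fst_sub, ContinuousMap.sub_apply, ContinuousMap.const_apply,
    volterra_one_apply] at h
  rw [Cont.ext_apply _ hx]
  linarith

lemma ivp_snd_ext (w : Potential) (c : ℝ × ℝ) {x : ℝ} (hx : x ∈ Icc (0 : ℝ) 1) :
    (ivp w c).2.ext x = c.2 + ∫ t in (0 : ℝ)..x, w t * (ivp w c).1.ext t := by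
  have h := congrArg (fun z : Cont × Cont => z.2 ⟨x, hx⟩) (ivp_sub_step w c)
  simp only [step_apply, Prod.snd_sub, ContinuousMap.sub_apply, ContinuousMap.const_apply,
    volterra_apply] at h
  rw [Cont.ext_apply _ hx]
  linarith

lemma ivp_fst_zero (w : Potential) (c : ℝ × ℝ) : (ivp w c).1.ext 0 = c.1 := by
  rw [ivp_fst_ext w c (by simp)]; simp

lemma ivp_snd_zero (w : Potential) (c : ℝ × ℝ) : (ivp w c).2.ext 0 = c.2 := by
  rw [ivp_snd_ext w c (by simp)]; simp

lemma isPair_ivp (w : Potential) (c : ℝ × ℝ) :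
    IsPair w (ivp w c).1.ext (ivp w c).2.ext where
  fst := ⟨(ivp w c).2.continuous_ext.intervalIntegrable _ _, fun x hx => by
    rw [ivp_fst_ext w c hx, ivp_fst_zero]⟩
  snd := ⟨w.intervalIntegrable_mul (ivp w c).1.continuous_ext (by simp) (by simp), fun x hx => by
    rw [ivp_snd_ext w c hx, ivp_snd_zero]⟩

lemma IsPair.eq_ivp {w : Potential} {u v : ℝ → ℝ} (h : IsPair w u v) {x : ℝ}
    (hx : x ∈ Icc (0 : ℝ) 1) :
    u x = (ivp w (u 0, v 0)).1.ext x ∧ v x = (ivp w (u 0, v 0)).2.ext x := by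
  let U : Cont := ⟨(Icc (0 : ℝ) 1).domRestrict u, h.fst.continuousOn.domRestrict⟩
  let V : Cont := ⟨(Icc (0 : ℝ) 1).domRestrict v, h.snd.continuousOn.domRestrict⟩
  have hU : ∀ t ∈ Icc (0 : ℝ) 1, U.ext t = u t := fun t ht => U.ext_apply ht
  have hV : ∀ t ∈ Icc (0 : ℝ) 1, V.ext t = v t := fun t ht => V.ext_apply ht
  have hz : (U, V) = ivp w (u 0, v 0) := by
    refine eq_ivp_of_sub_step _ _ _ ?_
    have hcc : ∀ x : Icc (0 : ℝ) 1, uIcc 0 (x : ℝ) ⊆ Icc 0 1 := fun x => by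
      rw [uIcc_of_le x.2.1]; exact Icc_subset_Icc le_rfl x.2.2
    refine Prod.ext (ContinuousMap.ext fun x => ?_) (ContinuousMap.ext fun x => ?_)
    · have h1 : U x = u x := rfl
      simp only [step_apply, Prod.fst_sub, ContinuousMap.sub_apply, ContinuousMap.const_apply,
        volterra_one_apply]
      rw [h1, h.fst.eq_integral x x.2, intervalIntegral.integral_congr (g := v)
        fun t ht => hV t (hcc x ht)]
      ring
    · have h1 : V x = v x := rfl
      simp only [step_apply, Prod.snd_sub, ContinuousMap.sub_apply, ContinuousMap.const_apply,
        volterra_apply]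
      rw [h1, h.snd.eq_integral x x.2, intervalIntegral.integral_congr
        (f := fun t => w t * U.ext t) (g := fun t => w t * u t)
        fun t ht => by simp only [hU t (hcc x ht)]]
      ring
  rw [← hz]
  exact ⟨(hU x hx).symm, (hV x hx).symm⟩

/-- The coefficient `q - μ` of the equation `u'' = (q - μ) u`. -/
def shift (q : Potential) (μ : ℝ) : Potential := q - μ • onePotential

lemma coeFn_shift (q : Potential) (μ : ℝ) :
    (shift q μ : ℝ → ℝ) =ᵐ[(volume : Measure ℝ).restrict (Icc (0 : ℝ) 1)] fun t => q t - μ := by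
  filter_upwards [Lp.coeFn_sub q (μ • onePotential), Lp.coeFn_smul μ onePotential,
    coeFn_onePotential] with t h1 h2 h3
  rw [shift, h1, Pi.sub_apply, h2, Pi.smul_apply, h3]
  simp

lemma IsSolution.isPair {q : Potential} {μ : ℝ} {u v : ℝ → ℝ} (h : IsSolution q μ u v) :
    IsPair (shift q μ) u v := by
  have hv := HasWeakDeriv.of_absolutelyContinuous h.absCont
  refine ⟨HasWeakDeriv.of_hasDerivWithinAt h.hasDeriv hv.continuousOn, hv.congr_ae ?_⟩
  filter_upwards [h.equation, coeFn_shift q μ] with t h1 h2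
  rw [h2]
  linarith

lemma IsPair.isSolution {q : Potential} {μ : ℝ} {u v : ℝ → ℝ} (h : IsPair (shift q μ) u v) :
    IsSolution q μ u v where
  hasDeriv _ hx := h.fst.hasDerivWithinAt h.snd.continuousOn hx
  absCont := h.snd.absolutelyContinuous
  equation := by
    filter_upwards [h.snd.ae_deriv_eq, coeFn_shift q μ] with t h1 h2
    rw [h1, h2]
    ring

end

end SturmLiouville

namespace SturmLiouville

/-! ### The characteristic function -/

noncomputable section

/-- The bounded bilinear map `(w, f) ↦ ∫₀¹ w f`. -/
def pairing : Potential →L[ℝ] Cont →L[ℝ] ℝ :=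
  (ContinuousLinearMap.compL ℝ Cont Cont ℝ (ContinuousMap.evalCLM ℝ ⟨1, by simp⟩)).comp volterra

lemma pairing_apply (w : Potential) (f : Cont) :
    pairing w f = ∫ t in (0 : ℝ)..1, w t * f.ext t := rfl

lemma pairing_one (f : Cont) : pairing onePotential f = ∫ t in (0 : ℝ)..1, f.ext t :=
  volterra_one_apply f ⟨1, by simp⟩

lemma abs_pairing_le (w : Potential) (f : Cont) : |pairing w f| ≤ ‖w‖ * ‖f‖ := by
  have h1 : |pairing w f| ≤ ‖primitiveMul w f‖ := (primitiveMul w f).norm_coe_le_norm _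
  exact h1.trans (by simpa using norm_primitiveMul_le w f)

lemma Potential.abs_integral_mul_le (w : Potential) {f : ℝ → ℝ} (hf : Continuous f) {B : ℝ}
    (hB : ∀ x ∈ Icc (0 : ℝ) 1, |f x| ≤ B) : |∫ t in (0 : ℝ)..1, w t * f t| ≤ ‖w‖ * B := by
  have hB0 : 0 ≤ B := (abs_nonneg _).trans (hB 0 (by simp))
  refine abs_le_of_sq_le_sq ?_ (by positivity)
  refine (w.sq_integral_mul_le hf (by simp)).trans ?_
  rw [mul_pow]
  refine mul_le_mul_of_nonneg_left ?_ (by positivity)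
  calc ∫ t in (0 : ℝ)..1, f t ^ 2 ≤ ∫ t in (0 : ℝ)..1, B ^ 2 := by
        refine intervalIntegral.integral_mono_on zero_le_one
          ((hf.pow 2).intervalIntegrable _ _) (by simp) fun t ht => ?_
        exact sq_le_sq' (neg_le_of_abs_le (hB t ht)) (le_of_abs_le (hB t ht))
    _ = B ^ 2 := by simp

/-- Triples `(a, b, q)` of the two boundary coefficients and the potential of a single
Sturm-Liouville problem. -/
abbrev Params : Type := ℝ × ℝ × Potential

/-- The solution `(u, u')` of `-u'' + q u = μ u` with `u(0) = 1` and `u'(0) = -a`, which spans the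
solutions of the boundary condition at `0`. -/
def leftSol (x : Params) (μ : ℝ) : Cont × Cont := ivp (shift x.2.2 μ) (1, -x.1)

/-- The characteristic function `b u(1) + u'(1)` of the problem `x = (a, b, q)`, where `u` is the
normalized solution of the boundary condition at `0`. Its zeros are the eigenvalues. -/
def charFn (x : Params) (μ : ℝ) : ℝ :=
  x.2.1 * (leftSol x μ).1.ext 1 + (leftSol x μ).2.ext 1

lemma continuous_leftSol : Continuous fun p : Params × ℝ => leftSol p.1 p.2 := by
  have h1 : Continuous fun p : Params × ℝ => shift p.1.2.2 p.2 := by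
    unfold shift
    fun_prop
  have h2 : Continuous fun p : Params × ℝ => ((1 : ℝ), -p.1.1) := by fun_prop
  exact Continuous.comp (g := fun p : Potential × (ℝ × ℝ) => ivp p.1 p.2)
    (f := fun p : Params × ℝ => (shift p.1.2.2 p.2, ((1 : ℝ), -p.1.1))) continuous_ivp
    (h1.prodMk h2)

lemma continuous_ext_one : Continuous fun f : Cont => f.ext 1 := by
  have : (fun f : Cont => f.ext 1) = fun f : Cont => f ⟨1, by simp⟩ := by
    funext f; exact f.ext_apply _
  rw [this]
  exact continuous_eval_const _

lemma continuous_charFn : Continuous fun p : Params × ℝ => charFn p.1 p.2 := by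
  unfold charFn
  have h1 := continuous_ext_one.comp (continuous_fst.comp continuous_leftSol)
  have h2 := continuous_ext_one.comp (continuous_snd.comp continuous_leftSol)
  exact ((continuous_fst.comp (continuous_snd.comp continuous_fst)).mul h1).add h2

lemma leftSol_fst_zero (x : Params) (μ : ℝ) : (leftSol x μ).1.ext 0 = 1 := ivp_fst_zero _ _

lemma leftSol_snd_zero (x : Params) (μ : ℝ) : (leftSol x μ).2.ext 0 = -x.1 := ivp_snd_zero _ _

lemma isPair_leftSol (x : Params) (μ : ℝ) :
    IsPair (shift x.2.2 μ) (leftSol x μ).1.ext (leftSol x μ).2.ext := isPair_ivp _ _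

lemma ivp_smul (w : Potential) (r : ℝ) (c : ℝ × ℝ) : ivp w (r * c.1, r * c.2) = r • ivp w c := by
  rw [ivp, ivp, ← map_smul]
  rfl

lemma isEigenvalue_iff (a b : ℝ) (q : Potential) (μ : ℝ) :
    IsEigenvalue a b q μ ↔ charFn (a, b, q) μ = 0 := by
  constructor
  · rintro ⟨u, v, hs, ⟨x, hx, hux⟩, h0, h1⟩
    have hv0 : v 0 = u 0 * (-a) := by linarith
    have key : ∀ y ∈ Icc (0 : ℝ) 1, u y = u 0 * (leftSol (a, b, q) μ).1.ext y ∧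
        v y = u 0 * (leftSol (a, b, q) μ).2.ext y := by
      intro y hy
      have := hs.isPair.eq_ivp hy
      have h2 := ivp_smul (shift q μ) (u 0) (1, -a)
      rw [mul_one, ← hv0] at h2
      rw [h2] at this
      exact this
    have hu0 : u 0 ≠ 0 := fun h => hux (by rw [(key x hx).1, h, zero_mul])
    have h2 := key 1 (by simp)
    rw [h2.1, h2.2] at h1
    have h3 : u 0 * charFn (a, b, q) μ = 0 := by
      rw [charFn]; linear_combination h1
    exact (mul_eq_zero.1 h3).resolve_left hu0
  · intro h
    refine ⟨_, _, (isPair_leftSol (a, b, q) μ).isSolution, ⟨0, by simp, ?_⟩, ?_, h⟩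
    · rw [leftSol_fst_zero]; exact one_ne_zero
    · rw [leftSol_fst_zero, leftSol_snd_zero]; simp

/-- The integrated Wronskian identity for the normalized solutions of two different problems. It
is exact, so it serves both for the location of the eigenvalues and for their derivatives. -/
lemma charFn_identity (x y : Params) (μ ν : ℝ) :
    (leftSol x μ).1.ext 1 * charFn y ν - (leftSol y ν).1.ext 1 * charFn x μ =
      (y.2.1 - x.2.1) * ((leftSol x μ).1.ext 1 * (leftSol y ν).1.ext 1) - (y.1 - x.1) +
        pairing (y.2.2 - x.2.2) ((leftSol x μ).1 * (leftSol y ν).1) -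
        (ν - μ) * pairing onePotential ((leftSol x μ).1 * (leftSol y ν).1) := by
  have h := ((isPair_leftSol x μ).wronskian (isPair_leftSol y ν)).integral_eq
  have h2 : pairing (shift y.2.2 ν - shift x.2.2 μ) ((leftSol x μ).1 * (leftSol y ν).1) =
      ∫ t in (0 : ℝ)..1, ((shift y.2.2 ν : ℝ → ℝ) t - (shift x.2.2 μ : ℝ → ℝ) t) *
        ((leftSol x μ).1.ext t * (leftSol y ν).1.ext t) := by
    rw [pairing_apply]
    refine intervalIntegral.integral_congr_ae_restrict ?_
    rw [uIoc_of_le zero_le_one]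
    filter_upwards [ae_restrict_of_ae_restrict_of_subset Ioc_subset_Icc_self
      (Lp.coeFn_sub (shift y.2.2 ν) (shift x.2.2 μ))] with t ht
    rw [ht]
    rfl
  have h3 : shift y.2.2 ν - shift x.2.2 μ = (y.2.2 - x.2.2) - (ν - μ) • onePotential := by
    rw [shift, shift, sub_smul]; abel
  rw [← h2, h3, map_sub, map_smul, leftSol_fst_zero, leftSol_fst_zero, leftSol_snd_zero,
    leftSol_snd_zero] at h
  simp only [_root_.sub_apply, _root_.smul_apply, smul_eq_mul] at h
  rw [charFn, charFn]
  linarith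

lemma mass_pos (x : Params) (μ : ℝ) :
    0 < pairing onePotential ((leftSol x μ).1 * (leftSol x μ).1) := by
  rw [pairing_one]
  refine intervalIntegral.integral_pos one_pos (Cont.continuous_ext _).continuousOn
    (fun t _ => mul_self_nonneg ((leftSol x μ).1.ext t)) ⟨0, by simp, ?_⟩
  change 0 < (leftSol x μ).1.ext 0 * (leftSol x μ).1.ext 0
  rw [leftSol_fst_zero]
  norm_num

lemma continuous_mass : Continuous fun p : Params × ℝ × ℝ =>
    pairing onePotential ((leftSol p.1 p.2.1).1 * (leftSol p.1 p.2.2).1) := by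
  have h1 : Continuous fun p : Params × ℝ × ℝ => (leftSol p.1 p.2.1).1 :=
    continuous_leftSol.fst.comp (f := fun p : Params × ℝ × ℝ => (p.1, p.2.1)) (by fun_prop)
  have h2 : Continuous fun p : Params × ℝ × ℝ => (leftSol p.1 p.2.2).1 :=
    continuous_leftSol.fst.comp (f := fun p : Params × ℝ × ℝ => (p.1, p.2.2)) (by fun_prop)
  have h3 : Continuous fun p : Params × ℝ × ℝ => (leftSol p.1 p.2.1).1 * (leftSol p.1 p.2.2).1 :=
    h1.mul h2
  exact (pairing onePotential).continuous.comp h3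

/-! ### A priori bounds -/

lemma HasWeakDeriv.le_add_integral {f f' h : ℝ → ℝ} (hf : HasWeakDeriv f f')
    (hi : IntervalIntegrable h volume 0 1)
    (hle : ∀ᵐ t ∂((volume : Measure ℝ).restrict (Icc (0 : ℝ) 1)), |f' t| ≤ h t)
    {x y : ℝ} (hx : x ∈ Icc (0 : ℝ) 1) (hy : y ∈ Icc (0 : ℝ) 1) :
    f x ≤ f y + ∫ t in (0 : ℝ)..1, h t := by
  have h1 := hf.sub_eq hy hx
  have hsub : uIoc y x ⊆ Ioc 0 1 := by
    intro t ht
    rw [mem_uIoc] at ht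
    rcases ht with ht | ht
    · exact ⟨hy.1.trans_lt ht.1, ht.2.trans hx.2⟩
    · exact ⟨hx.1.trans_lt ht.1, ht.2.trans hy.2⟩
  have hle' :=
    ae_restrict_of_ae_restrict_of_subset (Ioc_subset_Icc_self (a := (0 : ℝ)) (b := 1)) hle
  rw [intervalIntegrable_iff_integrableOn_Ioc_of_le zero_le_one] at hi
  have hf1 := hf.integrable
  rw [intervalIntegrable_iff_integrableOn_Ioc_of_le zero_le_one] at hf1
  have h2 : |∫ t in y..x, f' t| ≤ ∫ t in (0 : ℝ)..1, h t := by
    refine (intervalIntegral.norm_integral_le_integral_norm_uIoc (f := f')).trans ?_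
    rw [intervalIntegral.integral_of_le zero_le_one]
    refine (setIntegral_mono_set hf1.norm
      (Filter.Eventually.of_forall fun t => norm_nonneg (f' t)) hsub.eventuallyLE).trans ?_
    exact setIntegral_mono_ae_restrict hf1.norm hi hle'
  have := le_abs_self (∫ t in y..x, f' t)
  linarith

/-- The average over `y` of the preceding inequality. -/
lemma HasWeakDeriv.le_integral_add_integral {f f' h : ℝ → ℝ} (hf : HasWeakDeriv f f')
    (hi : IntervalIntegrable h volume 0 1)
    (hle : ∀ᵐ t ∂((volume : Measure ℝ).restrict (Icc (0 : ℝ) 1)), |f' t| ≤ h t)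
    {x : ℝ} (hx : x ∈ Icc (0 : ℝ) 1) :
    f x ≤ (∫ t in (0 : ℝ)..1, f t) + ∫ t in (0 : ℝ)..1, h t := by
  have hfi : IntervalIntegrable f volume 0 1 := by
    refine ContinuousOn.intervalIntegrable ?_
    rw [uIcc_of_le zero_le_one]
    exact hf.continuousOn
  have h1 : ∫ t in (0 : ℝ)..1, (f x - ∫ t in (0 : ℝ)..1, h t) ≤ ∫ t in (0 : ℝ)..1, f t := by
    refine intervalIntegral.integral_mono_on zero_le_one (by simp) hfi fun y hy => ?_
    linarith [hf.le_add_integral hi hle hx hy]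
  simp only [intervalIntegral.integral_const, sub_zero, smul_eq_mul, one_mul] at h1
  linarith

lemma Potential.integral_abs_le (q : Potential) : ∫ t in (0 : ℝ)..1, |q t| ≤ ‖q‖ := by
  have h := (|q| : Potential).abs_integral_mul_le (f := fun _ => 1) continuous_const (B := 1)
    (by simp)
  rw [norm_abs_eq_norm, mul_one] at h
  refine le_trans (le_of_eq ?_) ((le_abs_self _).trans h)
  refine intervalIntegral.integral_congr_ae_restrict ?_
  rw [uIoc_of_le zero_le_one]
  filter_upwards [ae_restrict_of_ae_restrict_of_subset Ioc_subset_Icc_self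
    (Lp.coeFn_abs q)] with t ht
  rw [ht, mul_one]

/-- For `μ = k²` large compared with `q`, the energy `u'² + k² u²` of a solution varies at most by
a factor of two. -/
lemma energy_le {q : Potential} {k : ℝ} (hk : 0 < k) (hq : 2 * ‖q‖ ≤ k) {u v : ℝ → ℝ}
    (h : IsPair (shift q (k ^ 2)) u v) {x y : ℝ} (hx : x ∈ Icc (0 : ℝ) 1)
    (hy : y ∈ Icc (0 : ℝ) 1) :
    v x ^ 2 + k ^ 2 * u x ^ 2 ≤ 2 * (v y ^ 2 + k ^ 2 * u y ^ 2) := by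
  set E : ℝ → ℝ := fun t => v t * v t + k ^ 2 * (u t * u t) with hE
  have hd : HasWeakDeriv E (fun t => 2 * q t * u t * v t) := by
    refine ((h.snd.mul h.snd).add ((h.fst.mul h.fst).const_mul (k ^ 2))).congr_ae ?_
    filter_upwards [coeFn_shift q (k ^ 2)] with t ht
    rw [ht]; ring
  obtain ⟨z, hz, hmax⟩ := isCompact_Icc.exists_isMaxOn (nonempty_Icc.2 zero_le_one) hd.continuousOn
  have hE0 : 0 ≤ E z := by
    have := mul_self_nonneg (v z)
    have := mul_self_nonneg (u z)
    positivity
  have hb : ∀ t ∈ Icc (0 : ℝ) 1, |2 * q t * u t * v t| ≤ |q t| * (E z / k) := by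
    intro t ht
    have h1 : E t ≤ E z := hmax ht
    have h2 : |2 * u t * v t| ≤ E z / k := by
      rw [le_div_iff₀ hk, ← abs_of_pos hk, ← abs_mul]
      refine le_trans ?_ h1
      simp only [hE]
      rw [abs_le]
      constructor <;>
        nlinarith [sq_nonneg (v t + k * u t), sq_nonneg (v t - k * u t), abs_of_pos hk]
    calc |2 * q t * u t * v t| = |q t| * |2 * u t * v t| := by rw [← abs_mul]; ring_nf
      _ ≤ _ := mul_le_mul_of_nonneg_left h2 (abs_nonneg _)
  have h3 := hd.le_add_integral (h := fun t => |q t| * (E z / k))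
    (q.intervalIntegrable.abs.mul_const _)
    ((ae_restrict_iff' measurableSet_Icc).2 (Filter.Eventually.of_forall hb)) hz hy
  rw [intervalIntegral.integral_mul_const] at h3
  have h4 : (∫ t in (0 : ℝ)..1, |q t|) * (E z / k) ≤ E z / 2 := by
    refine (mul_le_mul_of_nonneg_right q.integral_abs_le (by positivity)).trans ?_
    rw [mul_div_assoc', div_le_iff₀ hk]
    nlinarith
  have h5 : E x ≤ E z := hmax hx
  simp only [hE] at *
  nlinarith

/-- A bound for the size of a problem, in which all estimates below are expressed. -/
def Params.BoundedBy (x : Params) (C : ℝ) : Prop := 1 ≤ C ∧ |x.1| + |x.2.1| + ‖x.2.2‖ ≤ C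

section

variable {x : Params} {C μ : ℝ}

/-- A bound for `∫ u'²`, obtained by integrating `(u u')'` over `[0,1]` for an eigenfunction `u`. -/
lemma dirichlet_le (hx : x.BoundedBy C) (h : charFn x μ = 0) :
    pairing onePotential ((leftSol x μ).2 * (leftSol x μ).2) ≤
      μ * pairing onePotential ((leftSol x μ).1 * (leftSol x μ).1) +
        C * ‖(leftSol x μ).1‖ ^ 2 := by
  set U := (leftSol x μ).1 with hU
  set V := (leftSol x μ).2 with hV
  have hp := isPair_leftSol x μ
  rw [← hU, ← hV] at hp
  have h1 := (hp.fst.mul hp.snd).integral_eq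
  have e0 : U.ext 0 = 1 := leftSol_fst_zero x μ
  have e1 : V.ext 0 = -x.1 := leftSol_snd_zero x μ
  have e2 : V.ext 1 = -(x.2.1 * U.ext 1) := by
    rw [charFn, ← hU, ← hV] at h; linarith
  have h2 : ∫ t in (0 : ℝ)..1, (V.ext t * V.ext t + U.ext t * ((shift x.2.2 μ) t * U.ext t)) =
      pairing onePotential (V * V) + pairing (shift x.2.2 μ) (U * U) := by
    rw [pairing_one, pairing_apply, ← intervalIntegral.integral_add
      ((V * V).continuous_ext.intervalIntegrable _ _)
      (Potential.intervalIntegrable_mul _ (U * U).continuous_ext (by simp) (by simp))]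
    refine intervalIntegral.integral_congr fun t _ => ?_
    simp only [Cont.ext, IccExtend, Function.comp_apply, ContinuousMap.mul_apply]
    ring
  rw [h2, e0, e1, e2, shift, map_sub, map_smul] at h1
  simp only [_root_.sub_apply, _root_.smul_apply, smul_eq_mul] at h1
  have h3 := abs_le.1 (abs_pairing_le x.2.2 (U * U))
  have hUU : ‖U * U‖ ≤ ‖U‖ ^ 2 := (norm_mul_le U U).trans (le_of_eq (sq _).symm)
  have h4 : ‖x.2.2‖ * ‖U * U‖ ≤ ‖x.2.2‖ * ‖U‖ ^ 2 :=
    mul_le_mul_of_nonneg_left hUU (norm_nonneg _)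
  have h5 : 1 ≤ ‖U‖ ^ 2 := by
    have := U.abs_ext_le 0
    rw [e0, abs_one] at this
    nlinarith
  have h6 : (U.ext 1) ^ 2 ≤ ‖U‖ ^ 2 := by
    rw [← sq_abs]; exact pow_le_pow_left₀ (abs_nonneg _) (U.abs_ext_le 1) 2
  have h7 : -x.2.1 * (U.ext 1) ^ 2 ≤ |x.2.1| * ‖U‖ ^ 2 :=
    mul_le_mul (neg_le_abs _) h6 (sq_nonneg _) (abs_nonneg _)
  have h8 : x.1 ≤ |x.1| * ‖U‖ ^ 2 := by nlinarith [le_abs_self x.1, abs_nonneg x.1]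
  nlinarith [mul_le_mul_of_nonneg_right hx.2 (sq_nonneg ‖U‖)]

/-- An interpolation inequality: the supremum of `u²` is bounded by the `L²` norms of `u` and
`u'`. -/
lemma sq_norm_le {ε : ℝ} (hε : 0 < ε) (x : Params) (μ : ℝ) :
    ‖(leftSol x μ).1‖ ^ 2 ≤
      (1 + 1 / ε) * pairing onePotential ((leftSol x μ).1 * (leftSol x μ).1) +
        ε * pairing onePotential ((leftSol x μ).2 * (leftSol x μ).2) := by
  set U := (leftSol x μ).1 with hU
  set V := (leftSol x μ).2 with hV
  have hp := isPair_leftSol x μ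
  rw [← hU, ← hV] at hp
  have hd := hp.fst.mul hp.fst
  have hb : ∀ t, |V.ext t * U.ext t + U.ext t * V.ext t| ≤
      1 / ε * (U * U).ext t + ε * (V * V).ext t := by
    intro t
    change _ ≤ 1 / ε * (U.ext t * U.ext t) + ε * (V.ext t * V.ext t)
    have h1 : 0 ≤ (U.ext t + ε * V.ext t) ^ 2 / ε := by positivity
    have h2 : 0 ≤ (U.ext t - ε * V.ext t) ^ 2 / ε := by positivity
    have e1 : (U.ext t + ε * V.ext t) ^ 2 / ε = 1 / ε * (U.ext t * U.ext t) +
        2 * (U.ext t * V.ext t) + ε * (V.ext t * V.ext t) := by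
      field_simp
      ring
    have e2 : (U.ext t - ε * V.ext t) ^ 2 / ε = 1 / ε * (U.ext t * U.ext t) -
        2 * (U.ext t * V.ext t) + ε * (V.ext t * V.ext t) := by
      field_simp
      ring
    rw [abs_le]
    constructor <;> nlinarith
  have hi1 : IntervalIntegrable (fun t => 1 / ε * (U * U).ext t) volume 0 1 :=
    (continuous_const.mul (U * U).continuous_ext).intervalIntegrable _ _
  have hi2 : IntervalIntegrable (fun t => ε * (V * V).ext t) volume 0 1 :=
    (continuous_const.mul (V * V).continuous_ext).intervalIntegrable _ _
  have key : ∀ t : Icc (0 : ℝ) 1, U t ^ 2 ≤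
      (1 + 1 / ε) * pairing onePotential (U * U) + ε * pairing onePotential (V * V) := by
    intro t
    have h1 := hd.le_integral_add_integral (hi1.add hi2)
      (Filter.Eventually.of_forall hb) t.2
    rw [intervalIntegral.integral_add hi1 hi2, intervalIntegral.integral_const_mul,
      intervalIntegral.integral_const_mul, ← pairing_one, ← pairing_one, U.ext_apply t.2] at h1
    have h2 : ∫ t in (0 : ℝ)..1, U.ext t * U.ext t = pairing onePotential (U * U) :=
      (pairing_one (U * U)).symm
    rw [h2] at h1
    linarith [sq (U t)]
  have h0 : 0 ≤ (1 + 1 / ε) * pairing onePotential (U * U) + ε * pairing onePotential (V * V) :=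
    (sq_nonneg _).trans (key ⟨0, by simp⟩)
  rw [← Real.sqrt_le_sqrt_iff h0, Real.sqrt_sq (norm_nonneg _),
    ContinuousMap.norm_le _ (Real.sqrt_nonneg _)]
  intro t
  exact Real.abs_le_sqrt (key t)

/-- The eigenvalues are bounded below, locally uniformly in the problem. -/
lemma eigenvalue_lower_bound (hx : x.BoundedBy C) (h : charFn x μ = 0) :
    -(C * (1 + 2 * C)) ≤ μ := by
  have hC : 0 < C := by linarith [hx.1]
  have h1 := dirichlet_le hx h
  have h2 := sq_norm_le (ε := 1 / (2 * C)) (by positivity) x μ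
  have h3 := mass_pos x μ
  set S := pairing onePotential ((leftSol x μ).1 * (leftSol x μ).1)
  set D := pairing onePotential ((leftSol x μ).2 * (leftSol x μ).2) with hD
  have hD0 : 0 ≤ D := by
    rw [hD, pairing_one]
    exact intervalIntegral.integral_nonneg zero_le_one fun t _ =>
      mul_self_nonneg ((leftSol x μ).2.ext t)
  rw [one_div_one_div] at h2
  have h4 : C * ‖(leftSol x μ).1‖ ^ 2 ≤ C * ((1 + 2 * C) * S) + D / 2 := by
    refine (mul_le_mul_of_nonneg_left h2 hC.le).trans (le_of_eq ?_)
    field_simp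
  by_contra hlt
  push Not at hlt
  nlinarith

/-- The supremum of an eigenfunction is controlled by its `L²` norm, uniformly in the eigenvalue
and locally uniformly in the problem. -/
lemma sq_norm_leftSol_le (hx : x.BoundedBy C) (h : charFn x μ = 0) :
    ‖(leftSol x μ).1‖ ^ 2 ≤
      (2 + 8 * C) * pairing onePotential ((leftSol x μ).1 * (leftSol x μ).1) := by
  have hC1 := hx.1
  have hC : 0 < C := by linarith
  have h1 := dirichlet_le hx h
  have h3 := mass_pos x μ
  set S := pairing onePotential ((leftSol x μ).1 * (leftSol x μ).1) with hS
  set D := pairing onePotential ((leftSol x μ).2 * (leftSol x μ).2) with hD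
  set M := ‖(leftSol x μ).1‖ ^ 2 with hM
  rcases le_total μ (4 * C ^ 2) with hμ | hμ
  · have h2 := sq_norm_le (ε := 1 / (2 * C)) (by positivity) x μ
    rw [one_div_one_div, ← hS, ← hD, ← hM] at h2
    have h4 : C * M ≤ C * ((1 + 2 * C) * S) + D / 2 := by
      refine (mul_le_mul_of_nonneg_left h2 hC.le).trans (le_of_eq ?_)
      field_simp
    -- Absorbing the Dirichlet integral gives `C M ≤ (μ + 2 C (1 + 2 C)) S`.
    have h5 : C * M ≤ C * ((2 + 8 * C) * S) := by nlinarith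
    exact le_of_mul_le_mul_left h5 hC
  · have hμ0 : 0 < μ := lt_of_lt_of_le (by positivity) hμ
    obtain ⟨k, hk, rfl⟩ : ∃ k : ℝ, 0 < k ∧ μ = k ^ 2 :=
      ⟨√μ, Real.sqrt_pos.2 hμ0, (Real.sq_sqrt hμ0.le).symm⟩
    have hk2 : 2 * C ≤ k := by
      refine le_of_sq_le_sq ?_ hk.le
      nlinarith
    have hq : 2 * ‖x.2.2‖ ≤ k := by
      have := hx.2
      have := abs_nonneg x.1
      have := abs_nonneg x.2.1
      linarith
    set U := (leftSol x (k ^ 2)).1 with hU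
    set V := (leftSol x (k ^ 2)).2 with hV
    have hi1 : IntervalIntegrable (fun t => (V * V).ext t) volume 0 1 :=
      (V * V).continuous_ext.intervalIntegrable _ _
    have hi2 : IntervalIntegrable (fun t => k ^ 2 * (U * U).ext t) volume 0 1 :=
      (continuous_const.mul (U * U).continuous_ext).intervalIntegrable _ _
    have key : ∀ t : Icc (0 : ℝ) 1, U t ^ 2 ≤ 2 * (D + k ^ 2 * S) / k ^ 2 := by
      intro t
      have h4 : ∫ y in (0 : ℝ)..1, (k ^ 2 * U t ^ 2) ≤
          ∫ y in (0 : ℝ)..1, 2 * ((V * V).ext y + k ^ 2 * (U * U).ext y) := by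
        refine intervalIntegral.integral_mono_on zero_le_one (by simp)
          ((hi1.add hi2).const_mul 2) fun y hy => ?_
        have h5 := energy_le hk hq (isPair_leftSol x (k ^ 2)) t.2 hy
        rw [← hU, ← hV, U.ext_apply t.2] at h5
        change _ ≤ 2 * (V.ext y * V.ext y + k ^ 2 * (U.ext y * U.ext y))
        nlinarith [sq_nonneg (V.ext t)]
      rw [intervalIntegral.integral_const_mul 2, intervalIntegral.integral_add hi1 hi2,
        intervalIntegral.integral_const_mul (k ^ 2) fun y => (U * U).ext y, ← pairing_one,
        ← pairing_one, ← hS, ← hD] at h4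
      simp only [intervalIntegral.integral_const, sub_zero, smul_eq_mul, one_mul] at h4
      rw [le_div_iff₀ (by positivity)]
      linarith
    have h0 : 0 ≤ 2 * (D + k ^ 2 * S) / k ^ 2 := (sq_nonneg _).trans (key ⟨0, by simp⟩)
    have hM2 : M ≤ 2 * (D + k ^ 2 * S) / k ^ 2 := by
      rw [hM, ← Real.sqrt_le_sqrt_iff h0, Real.sqrt_sq (norm_nonneg _),
        ContinuousMap.norm_le _ (Real.sqrt_nonneg _)]
      exact fun t => Real.abs_le_sqrt (key t)
    rw [le_div_iff₀ (by positivity)] at hM2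
    have hM0 : 0 ≤ M := sq_nonneg _
    -- Now `k² M ≤ 4 k² S + 2 C M` with `2 C M ≤ k² M / 2`, so `M ≤ 8 S`.
    have h6 : 4 * C ≤ k ^ 2 := by nlinarith
    have h7 : M ≤ 8 * S := by
      refine le_of_mul_le_mul_left ?_ hμ0
      nlinarith [mul_le_mul_of_nonneg_right h6 hM0]
    nlinarith

end

/-! ### Existence of infinitely many eigenvalues -/

lemma sin_mul_charFn_neg {x : Params} {C k : ℝ} (hx : x.BoundedBy C) (hk : 3 * C < k)
    (hcos : Real.cos k = 0) : Real.sin k * charFn x (k ^ 2) < 0 := by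
  have hC1 := hx.1
  have hk0 : 0 < k := by linarith
  have ha := abs_nonneg x.1
  have hb := abs_nonneg x.2.1
  have hqn := norm_nonneg x.2.2
  have hx2 := hx.2
  have hq : 2 * ‖x.2.2‖ ≤ k := by linarith
  have hp := isPair_leftSol x (k ^ 2)
  set U := (leftSol x (k ^ 2)).1 with hU
  set V := (leftSol x (k ^ 2)).2 with hV
  have e0 : U.ext 0 = 1 := leftSol_fst_zero x _
  have e1 : V.ext 0 = -x.1 := leftSol_snd_zero x _
  have hub : ∀ t ∈ Icc (0 : ℝ) 1, |U.ext t| ≤ 2 := by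
    intro t ht
    have h := energy_le hk0 hq hp ht (y := 0) (by simp)
    rw [e0, e1] at h
    have h1 : x.1 ^ 2 ≤ k ^ 2 := by
      rw [← sq_abs]; exact pow_le_pow_left₀ ha (by linarith) 2
    have h2 : k ^ 2 * U.ext t ^ 2 ≤ k ^ 2 * 2 ^ 2 := by nlinarith [sq_nonneg (V.ext t)]
    exact abs_le_of_sq_le_sq (le_of_mul_le_mul_left h2 (by positivity)) (by norm_num)
  have hq2 : ∀ (f g : ℝ → ℝ), IsPair (fun _ => -k ^ 2) f g → Continuous f → (∀ t, |f t| ≤ 1) →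
      |f 1 * V.ext 1 - g 1 * U.ext 1 - (f 0 * (-x.1) - g 0)| ≤ 2 * C := by
    intro f g hfg hfc hf1
    have h := (hfg.wronskian hp).integral_eq
    have h2 : ∫ t in (0 : ℝ)..1, ((shift x.2.2 (k ^ 2)) t - -k ^ 2) * (f t * U.ext t) =
        ∫ t in (0 : ℝ)..1, x.2.2 t * (f t * U.ext t) := by
      refine intervalIntegral.integral_congr_ae_restrict ?_
      rw [uIoc_of_le zero_le_one]
      filter_upwards [ae_restrict_of_ae_restrict_of_subset Ioc_subset_Icc_self
        (coeFn_shift x.2.2 (k ^ 2))] with t ht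
      rw [ht]; ring
    rw [e0, e1, mul_one, h2] at h
    rw [← h]
    refine (x.2.2.abs_integral_mul_le (hfc.mul U.continuous_ext) (B := 2) fun t ht => ?_).trans
      (by linarith)
    rw [Pi.mul_apply, abs_mul]
    nlinarith [hf1 t, hub t ht, abs_nonneg (f t), abs_nonneg (U.ext t)]
  have hdk : ∀ t : ℝ, HasDerivAt (fun t => k * t) k t := fun t => by
    simpa using (hasDerivAt_id t).const_mul k
  have hcosd : ∀ t : ℝ, HasDerivAt (fun t => Real.cos (k * t)) (-k * Real.sin (k * t)) t :=
    fun t => by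
      have := (Real.hasDerivAt_cos (k * t)).comp t (hdk t)
      convert! this using 1; ring
  have hsind : ∀ t : ℝ, HasDerivAt (fun t => Real.sin (k * t)) (k * Real.cos (k * t)) t :=
    fun t => by
      have := (Real.hasDerivAt_sin (k * t)).comp t (hdk t)
      convert! this using 1; ring
  have hc := hq2 (fun t => Real.cos (k * t)) (fun t => -k * Real.sin (k * t))
    ⟨.of_hasDerivAt hcosd (by fun_prop),
      ((HasWeakDeriv.of_hasDerivAt hsind (by fun_prop)).const_mul (-k)).congr
        fun t _ => by ring⟩ (by fun_prop) (fun t => Real.abs_cos_le_one _)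
  have hs := hq2 (fun t => Real.sin (k * t)) (fun t => k * Real.cos (k * t))
    ⟨.of_hasDerivAt hsind (by fun_prop),
      ((HasWeakDeriv.of_hasDerivAt hcosd (by fun_prop)).const_mul k).congr
        fun t _ => by ring⟩ (by fun_prop) (fun t => Real.abs_sin_le_one _)
  simp only [mul_one, mul_zero, Real.cos_zero, Real.sin_zero, hcos, zero_mul, one_mul, sub_zero,
    zero_sub, sub_neg_eq_add] at hc hs
  -- Up to bounded terms, `u'(1) = -k sin k` and `k u(1) = 0`.
  have hs2 : |Real.sin k * U.ext 1| ≤ 1 := by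
    have h1 : k * |Real.sin k * U.ext 1| ≤ k * 1 := by
      rw [← abs_of_pos hk0, ← abs_mul, abs_of_pos hk0, mul_one]
      have h2 := abs_le.1 hc
      have h3 := abs_le.1 (le_refl |x.1|)
      rw [abs_le]
      constructor <;> nlinarith
    exact le_of_mul_le_mul_left h1 hk0
  have h5 := (abs_le.1 hs).2
  have h6 : x.2.1 * (Real.sin k * U.ext 1) ≤ |x.2.1| := by
    refine (le_abs_self _).trans ?_
    rw [abs_mul]
    exact mul_le_of_le_one_right hb hs2
  rw [charFn, ← hU, ← hV]
  nlinarith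

lemma Params.exists_boundedBy (x : Params) : ∃ C, x.BoundedBy C :=
  ⟨1 + (|x.1| + |x.2.1| + ‖x.2.2‖), by
    have := abs_nonneg x.1
    have := abs_nonneg x.2.1
    have := norm_nonneg x.2.2
    linarith, by linarith⟩

lemma not_bddAbove_eigenvalues (x : Params) : ¬ BddAbove {μ | charFn x μ = 0} := by
  rintro ⟨T, hT⟩
  obtain ⟨C, hC⟩ := x.exists_boundedBy
  have hC1 := hC.1
  obtain ⟨n, hn⟩ := exists_nat_gt (3 * C + |T|)
  set k : ℝ := Real.pi / 2 + n * (2 * Real.pi) with hk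
  have hpi := Real.pi_gt_three
  have hn0 : (0 : ℝ) ≤ n := Nat.cast_nonneg n
  have hkn : (n : ℝ) ≤ k := by nlinarith
  have hT0 := abs_nonneg T
  have hcos : Real.cos k = 0 := by rw [hk, Real.cos_add_nat_mul_two_pi, Real.cos_pi_div_two]
  have hsin : Real.sin k = 1 := by rw [hk, Real.sin_add_nat_mul_two_pi, Real.sin_pi_div_two]
  have h1 := sin_mul_charFn_neg hC (k := k) (by linarith) hcos
  have h2 := sin_mul_charFn_neg hC (k := k + Real.pi) (by linarith)
    (by rw [Real.cos_add_pi, hcos, neg_zero])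
  rw [hsin, one_mul] at h1
  rw [Real.sin_add_pi, hsin, neg_one_mul, neg_lt_zero] at h2
  have hle : k ^ 2 ≤ (k + Real.pi) ^ 2 := by nlinarith
  have hcont : ContinuousOn (charFn x) (Icc (k ^ 2) ((k + Real.pi) ^ 2)) :=
    (continuous_charFn.comp (continuous_const.prodMk continuous_id)).continuousOn
  obtain ⟨μ, hμ, hμ0⟩ := intermediate_value_Icc hle hcont ⟨h1.le, h2.le⟩
  have h3 : μ ≤ T := hT hμ0
  have h4 : T < k ^ 2 := by nlinarith [le_abs_self T]
  linarith [hμ.1]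

end

end SturmLiouville

namespace SturmLiouville

/-! ### Enumeration of the eigenvalues and their continuity -/

open Filter Topology

lemma exists_encard_inter_Iio_eq {A : Set ℝ} (hfin : ∀ T, (A ∩ Iic T).Finite)
    (hunb : ¬ BddAbove A) (n : ℕ) : ∃ μ ∈ A, (A ∩ Iio μ).encard = n := by
  have hmin : ∀ B ⊆ A, B.Nonempty → ∃ μ ∈ B, ∀ ν ∈ B, μ ≤ ν := by
    rintro B hB ⟨T, hT⟩
    obtain ⟨μ, hμ, h⟩ := Set.exists_min_image (B ∩ Iic T) id
      ((hfin T).subset (inter_subset_inter_left _ hB)) ⟨T, hT, self_mem_Iic⟩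
    refine ⟨μ, hμ.1, fun ν hν => ?_⟩
    rcases le_total ν T with h1 | h1
    · exact h ν ⟨hν, h1⟩
    · exact hμ.2.trans h1
  induction n with
  | zero =>
    obtain ⟨μ, hμ, h⟩ := hmin A le_rfl (nonempty_iff_ne_empty.2 fun h => hunb (by simp [h]))
    refine ⟨μ, hμ, ?_⟩
    rw [Nat.cast_zero, encard_eq_zero, eq_empty_iff_forall_notMem]
    rintro ν ⟨hν, hlt⟩
    exact absurd (h ν hν) (not_le.2 hlt)
  | succ n ih =>
    obtain ⟨μ, hμ, hn⟩ := ih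
    obtain ⟨T, hT, hμT⟩ := not_bddAbove_iff.1 hunb μ
    obtain ⟨ν, hν, h⟩ := hmin (A ∩ Ioi μ) inter_subset_left ⟨T, hT, hμT⟩
    refine ⟨ν, hν.1, ?_⟩
    have : A ∩ Iio ν = insert μ (A ∩ Iio μ) := by
      ext t
      constructor
      · rintro ⟨ht, htν⟩
        rcases lt_trichotomy t μ with h1 | h1 | h1
        · exact Or.inr ⟨ht, h1⟩
        · exact Or.inl h1
        · exact absurd (h t ⟨ht, h1⟩) (not_le.2 htν)
      · rintro (rfl | ⟨ht, htμ⟩)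
        · exact ⟨hμ, hν.2⟩
        · exact ⟨ht, mem_Iio.2 (lt_trans (mem_Iio.1 htμ) (mem_Ioi.1 hν.2))⟩
    rw [this, encard_insert_of_notMem (fun h => lt_irrefl μ (mem_Iio.1 h.2)), hn]
    rfl

lemma encard_add_one_le {A : Set ℝ} {μ ν : ℝ} (hμ : μ ∈ A) (hlt : μ < ν) :
    (A ∩ Iio μ).encard + 1 ≤ (A ∩ Iio ν).encard := by
  rw [← encard_insert_of_notMem (a := μ) (fun h => lt_irrefl μ (mem_Iio.1 h.2))]
  refine encard_le_encard ?_
  rintro t (rfl | ⟨ht, htμ⟩)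
  · exact ⟨hμ, hlt⟩
  · exact ⟨ht, mem_Iio.2 (lt_trans (mem_Iio.1 htμ) hlt)⟩

lemma eq_of_encard_inter_Iio_eq {A : Set ℝ} {μ ν : ℝ} {n : ℕ} (hμ : μ ∈ A) (hν : ν ∈ A)
    (h1 : (A ∩ Iio μ).encard = n) (h2 : (A ∩ Iio ν).encard = n) : μ = ν := by
  have key : ∀ {s t : ℝ}, s ∈ A → (A ∩ Iio s).encard = n → (A ∩ Iio t).encard = n → ¬ s < t := by
    intro s t hs h3 h4 hlt
    have h := encard_add_one_le hs hlt
    rw [h3, h4] at h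
    exact absurd h (not_le.2 (by exact_mod_cast Nat.lt_succ_self n))
  exact le_antisymm (not_lt.1 (key hν h2 h1)) (not_lt.1 (key hμ h1 h2))

/-- The set of eigenvalues of the problem `x`. -/
def eigenvalues (x : Params) : Set ℝ := {μ | charFn x μ = 0}

/-- For parameters close to `μ` and problems close to `x`, any two normalized solutions of the left
boundary condition have positive inner product. -/
lemma eventually_mass_pos (x : Params) (μ : ℝ) : ∃ δ > 0, ∀ᶠ y in 𝓝 x,
    ∀ μ₁ ∈ Ioo (μ - δ) (μ + δ), ∀ μ₂ ∈ Ioo (μ - δ) (μ + δ),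
      0 < pairing onePotential ((leftSol y μ₁).1 * (leftSol y μ₂).1) := by
  have h : ∀ᶠ p : Params × ℝ × ℝ in 𝓝 (x, μ, μ),
      0 < pairing onePotential ((leftSol p.1 p.2.1).1 * (leftSol p.1 p.2.2).1) :=
    (isOpen_lt continuous_const continuous_mass).mem_nhds (mass_pos x μ)
  rw [nhds_prod_eq, eventually_prod_iff] at h
  obtain ⟨pa, ha, pb, hb, H⟩ := h
  obtain ⟨δ, hδ, hb⟩ := Metric.eventually_nhds_iff.1 hb
  refine ⟨δ, hδ, ha.mono fun y hy μ₁ h1 μ₂ h2 => ?_⟩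
  refine H hy (y := (μ₁, μ₂)) (hb ?_)
  rw [Prod.dist_eq, max_lt_iff, Real.dist_eq, Real.dist_eq, abs_lt, abs_lt]
  exact ⟨⟨by linarith [h1.1], by linarith [h1.2]⟩, ⟨by linarith [h2.1], by linarith [h2.2]⟩⟩

/-- Nearby problems have at most one eigenvalue near `μ`, by the orthogonality of eigenfunctions. -/
lemma eventually_eigenvalue_unique (x : Params) (μ : ℝ) : ∃ δ > 0, ∀ᶠ y in 𝓝 x,
    ∀ μ₁ ∈ Ioo (μ - δ) (μ + δ), ∀ μ₂ ∈ Ioo (μ - δ) (μ + δ),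
      charFn y μ₁ = 0 → charFn y μ₂ = 0 → μ₁ = μ₂ := by
  obtain ⟨δ, hδ, h⟩ := eventually_mass_pos x μ
  refine ⟨δ, hδ, h.mono fun y hy μ₁ h1 μ₂ h2 e1 e2 => ?_⟩
  have hid := charFn_identity y y μ₁ μ₂
  rw [e1, e2] at hid
  simp only [sub_self, mul_zero, zero_mul, map_zero, _root_.zero_apply, zero_add,
    zero_sub, zero_eq_neg] at hid
  have := (mul_eq_zero.1 hid).resolve_right (hy μ₁ h1 μ₂ h2).ne'
  linarith

/-- All zeros of the characteristic function are simple: it changes sign at each of them. -/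
lemma charFn_sign_change {x : Params} {μ : ℝ} (h : charFn x μ = 0) : ∃ δ > 0,
    ∀ s ∈ Ioo (μ - δ) μ, ∀ t ∈ Ioo μ (μ + δ), charFn x s * charFn x t < 0 := by
  obtain ⟨δ, hδ, hm⟩ := eventually_mass_pos x μ
  replace hm := hm.self_of_nhds
  refine ⟨δ, hδ, fun s hs t ht => ?_⟩
  have hμ : μ ∈ Ioo (μ - δ) (μ + δ) := ⟨by linarith, by linarith⟩
  have key : ∀ ν, (leftSol x μ).1.ext 1 * charFn x ν =
      -((ν - μ) * pairing onePotential ((leftSol x μ).1 * (leftSol x ν).1)) := by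
    intro ν
    have hid := charFn_identity x x μ ν
    rw [h] at hid
    simpa using hid
  have h1 := hm μ hμ s ⟨hs.1, by linarith [hs.2]⟩
  have h2 := hm μ hμ t ⟨by linarith [ht.1], ht.2⟩
  have h3 := mul_pos (sub_pos.2 hs.2) h1
  have h4 := mul_pos (sub_pos.2 ht.1) h2
  have h5 := key s
  have h6 := key t
  have h7 : (leftSol x μ).1.ext 1 ^ 2 * (charFn x s * charFn x t) < 0 := by
    have : (leftSol x μ).1.ext 1 ^ 2 * (charFn x s * charFn x t) =
        -(((μ - s) * pairing onePotential ((leftSol x μ).1 * (leftSol x s).1)) *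
        ((t - μ) * pairing onePotential ((leftSol x μ).1 * (leftSol x t).1))) := by
      linear_combination ((leftSol x μ).1.ext 1 * charFn x t) * h5 -
        ((s - μ) * pairing onePotential ((leftSol x μ).1 * (leftSol x s).1)) * h6
    rw [this]
    exact neg_lt_zero.2 (mul_pos h3 h4)
  by_contra hcon
  push Not at hcon
  exact absurd h7 (not_lt.2 (mul_nonneg (sq_nonneg _) hcon))

lemma continuous_charFn_right (x : Params) : Continuous (charFn x) :=
  continuous_charFn.comp (continuous_const.prodMk continuous_id)

lemma continuous_charFn_left (μ : ℝ) : Continuous fun x => charFn x μ :=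
  continuous_charFn.comp (continuous_id.prodMk continuous_const)

lemma Params.eventually_boundedBy (x : Params) : ∃ C, ∀ᶠ y in 𝓝 x, Params.BoundedBy y C := by
  refine ⟨2 + (|x.1| + |x.2.1| + ‖x.2.2‖), ?_⟩
  have hc : Continuous fun y : Params => |y.1| + |y.2.1| + ‖y.2.2‖ := by fun_prop
  have := (hc.continuousAt (x := x)).eventually_lt_const
    (lt_add_of_pos_left (|x.1| + |x.2.1| + ‖x.2.2‖) (show (0 : ℝ) < 2 by norm_num))
  refine this.mono fun y hy => ⟨?_, hy.le⟩
  have := abs_nonneg x.1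
  have := abs_nonneg x.2.1
  have := norm_nonneg x.2.2
  linarith

lemma eventually_eigenvalues_bddBelow (x : Params) :
    ∃ m, ∀ᶠ y in 𝓝 x, ∀ μ ∈ eigenvalues y, m ≤ μ := by
  obtain ⟨C, hC⟩ := x.eventually_boundedBy
  exact ⟨_, hC.mono fun y hy μ hμ => eigenvalue_lower_bound hy hμ⟩

lemma finite_eigenvalues_inter_Iic (x : Params) (T : ℝ) : (eigenvalues x ∩ Iic T).Finite := by
  obtain ⟨m, hm⟩ := eventually_eigenvalues_bddBelow x
  replace hm := hm.self_of_nhds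
  by_contra hinf
  have hsub : eigenvalues x ∩ Iic T ⊆ Icc m T := fun μ hμ => ⟨hm μ hμ.1, hμ.2⟩
  obtain ⟨z, -, hacc⟩ := Set.Infinite.exists_accPt_of_subset_isCompact hinf isCompact_Icc hsub
  rw [accPt_iff_frequently] at hacc
  obtain ⟨δ, hδ, hu⟩ := eventually_eigenvalue_unique x z
  replace hu := hu.self_of_nhds
  have hz : charFn x z = 0 := by
    have hcl : IsClosed (eigenvalues x) :=
      isClosed_eq (continuous_charFn_right x) continuous_const
    exact hcl.mem_of_frequently_of_tendsto (hacc.mono fun y hy => hy.2.1) tendsto_id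
  have hnear : ∀ᶠ y in 𝓝 z, y ∈ Ioo (z - δ) (z + δ) :=
    Ioo_mem_nhds (by linarith) (by linarith)
  obtain ⟨y, ⟨hne, hy⟩, hyδ⟩ := (hacc.and_eventually hnear).exists
  exact hne (hu y hyδ z ⟨by linarith, by linarith⟩ hy.1 hz)

/-- Every eigenvalue continues to exactly one eigenvalue of every nearby problem. -/
lemma exists_isolating_nhds {x : Params} {z : ℝ} (hz : charFn x z = 0) {N : Set ℝ}
    (hN : N ∈ 𝓝 z) : ∃ O ⊆ N, IsOpen O ∧ z ∈ O ∧
      ∀ᶠ y in 𝓝 x, ∃! ζ, ζ ∈ O ∧ charFn y ζ = 0 := by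
  obtain ⟨δ₁, hδ₁, hu⟩ := eventually_eigenvalue_unique x z
  obtain ⟨δ₂, hδ₂, hs⟩ := charFn_sign_change hz
  obtain ⟨δ₃, hδ₃, hball⟩ := Metric.mem_nhds_iff.1 hN
  rw [Real.ball_eq_Ioo] at hball
  set e := min δ₁ (min δ₂ δ₃) with he
  have he0 : 0 < e := lt_min hδ₁ (lt_min hδ₂ hδ₃)
  have he1 : e ≤ δ₁ := min_le_left _ _
  have he2 : e ≤ δ₂ := (min_le_right _ _).trans (min_le_left _ _)
  have he3 : e ≤ δ₃ := (min_le_right _ _).trans (min_le_right _ _)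
  refine ⟨Ioo (z - e) (z + e), (Ioo_subset_Ioo (by linarith) (by linarith)).trans hball,
    isOpen_Ioo, ⟨by linarith, by linarith⟩, ?_⟩
  have hneg := hs (z - e / 2) ⟨by linarith, by linarith⟩ (z + e / 2) ⟨by linarith, by linarith⟩
  have hev := (((continuous_charFn_left (z - e / 2)).mul
    (continuous_charFn_left (z + e / 2))).continuousAt (x := x)).eventually_lt_const hneg
  filter_upwards [hu, hev] with y hy1 hy2
  have hcont : ContinuousOn (charFn y) (Icc (z - e / 2) (z + e / 2)) :=
    (continuous_charFn_right y).continuousOn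
  have hle : z - e / 2 ≤ z + e / 2 := by linarith
  have hex : ∃ ζ ∈ Icc (z - e / 2) (z + e / 2), charFn y ζ = 0 := by
    rcases mul_neg_iff.1 hy2 with ⟨h1, h2⟩ | ⟨h1, h2⟩
    · obtain ⟨ζ, h3, h4⟩ := intermediate_value_Icc' hle hcont ⟨h2.le, h1.le⟩
      exact ⟨ζ, h3, h4⟩
    · obtain ⟨ζ, h3, h4⟩ := intermediate_value_Icc hle hcont ⟨h1.le, h2.le⟩
      exact ⟨ζ, h3, h4⟩
  obtain ⟨ζ, hζ, hζ0⟩ := hex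
  refine ⟨ζ, ⟨⟨by linarith [hζ.1], by linarith [hζ.2]⟩, hζ0⟩, fun ξ hξ => ?_⟩
  exact hy1 ξ ⟨by linarith [hξ.1.1], by linarith [hξ.1.2]⟩ ζ
    ⟨by linarith [hζ.1], by linarith [hζ.2]⟩ hξ.2 hζ0

/-- The number of eigenvalues below a number `T` that is not an eigenvalue is locally constant. -/
lemma eventually_encard_eq {x : Params} {T : ℝ} (hT : charFn x T ≠ 0) :
    ∀ᶠ y in 𝓝 x, (eigenvalues y ∩ Iio T).encard = (eigenvalues x ∩ Iio T).encard := by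
  obtain ⟨m, hm⟩ := eventually_eigenvalues_bddBelow x
  set S := eigenvalues x ∩ Iio T with hS
  have hfin : S.Finite := (finite_eigenvalues_inter_Iic x T).subset
    (inter_subset_inter_right _ Iio_subset_Iic_self)
  obtain ⟨U, hU, hdisj⟩ := hfin.t2_separation
  have hiso : ∀ z : ℝ, ∃ O : Set ℝ, z ∈ S → (O ⊆ U z ∩ Iio T ∧ IsOpen O ∧ z ∈ O ∧
      ∀ᶠ y in 𝓝 x, ∃! ζ, ζ ∈ O ∧ charFn y ζ = 0) := by
    intro z
    by_cases hz : z ∈ S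
    · obtain ⟨O, h⟩ := exists_isolating_nhds hz.1
        (inter_mem ((hU z).2.mem_nhds (hU z).1) (Iio_mem_nhds hz.2))
      exact ⟨O, fun _ => h⟩
    · exact ⟨∅, fun h => absurd h hz⟩
  choose O hO using hiso
  have hopen : IsOpen (⋃ z ∈ S, O z) := isOpen_biUnion fun z hz => (hO z hz).2.1
  have hK : IsCompact (Icc m T \ ⋃ z ∈ S, O z) := isCompact_Icc.diff hopen
  have hne : ∀ᶠ y in 𝓝 x, ∀ t ∈ Icc m T \ ⋃ z ∈ S, O z, charFn y t ≠ 0 := by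
    refine hK.eventually_forall_of_forall_eventually fun t ht => ?_
    have h0 : charFn x t ≠ 0 := by
      intro h0
      rcases lt_or_eq_of_le ht.1.2 with h1 | h1
      · exact ht.2 (mem_biUnion (show t ∈ S from ⟨h0, h1⟩) (hO t ⟨h0, h1⟩).2.2.1)
      · exact hT (h1 ▸ h0)
    exact (continuous_charFn.continuousAt (x := (x, t))).eventually_ne h0
  have hex : ∀ᶠ y in 𝓝 x, ∀ z ∈ S, ∃! ζ, ζ ∈ O z ∧ charFn y ζ = 0 :=
    hfin.eventually_all.2 fun z hz => (hO z hz).2.2.2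
  filter_upwards [hm, hne, hex] with y hy1 hy2 hy3
  choose! ζ hζ hζu using hy3
  have himage : eigenvalues y ∩ Iio T = ζ '' S := by
    ext t
    constructor
    · rintro ⟨ht, htT⟩
      by_contra hcon
      refine hy2 t ⟨⟨hy1 t ht, le_of_lt htT⟩, fun hmem => ?_⟩ ht
      obtain ⟨z, hz, htz⟩ := mem_iUnion₂.1 hmem
      exact hcon ⟨z, hz, (hζu z hz t ⟨htz, ht⟩).symm⟩
    · rintro ⟨z, hz, rfl⟩
      exact ⟨(hζ z hz).2, ((hO z hz).1 (hζ z hz).1).2⟩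
  have hinj : InjOn ζ S := by
    intro z hz z' hz' h
    by_contra hne
    have h1 := ((hO z hz).1 (hζ z hz).1).1
    have h2 := ((hO z' hz').1 (hζ z' hz').1).1
    rw [h] at h1
    exact (disjoint_left.1 (hdisj hz hz' hne)) h1 h2
  rw [himage, hinj.encard_image]

/-- The `n`-th eigenvalue as a function on the space of triples `(a, b, q)`. -/
noncomputable def nthEigenvalue (n : ℕ) (x : Params) : ℝ := eigenvalue x.1 x.2.1 x.2.2 n

lemma nthEigenvalue_spec (n : ℕ) (x : Params) : charFn x (nthEigenvalue n x) = 0 ∧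
    (eigenvalues x ∩ Iio (nthEigenvalue n x)).encard = n := by
  obtain ⟨μ, hμ, hn⟩ := exists_encard_inter_Iio_eq (finite_eigenvalues_inter_Iic x)
    (not_bddAbove_eigenvalues x) n
  have hset : {μ : ℝ | IsEigenvalue x.1 x.2.1 x.2.2 μ ∧
      {ν : ℝ | IsEigenvalue x.1 x.2.1 x.2.2 ν ∧ ν < μ}.encard = n} = {μ} := by
    have h1 : ∀ ν, IsEigenvalue x.1 x.2.1 x.2.2 ν ↔ ν ∈ eigenvalues x :=
      fun ν => isEigenvalue_iff _ _ _ _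
    ext ν
    simp only [h1]
    constructor
    · rintro ⟨h2, h3⟩
      exact eq_of_encard_inter_Iio_eq h2 hμ h3 hn
    · rintro rfl
      exact ⟨hμ, hn⟩
  have h : nthEigenvalue n x = μ := by
    rw [nthEigenvalue, eigenvalue, hset, csInf_singleton]
  rw [h]
  exact ⟨hμ, hn⟩

lemma nthEigenvalue_injective (x : Params) : Function.Injective fun n => nthEigenvalue n x := by
  intro n m h
  have h1 := (nthEigenvalue_spec n x).2
  have h2 := (nthEigenvalue_spec m x).2
  simp only at h
  rw [h, h2] at h1
  exact_mod_cast h1.symm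

lemma continuous_nthEigenvalue (n : ℕ) : Continuous (nthEigenvalue n) := by
  rw [continuous_iff_continuousAt]
  intro x
  obtain ⟨hz, hn⟩ := nthEigenvalue_spec n x
  rw [ContinuousAt, Metric.tendsto_nhds]
  intro ε hε
  set z := nthEigenvalue n x
  obtain ⟨δ, hδ, hu⟩ := eventually_eigenvalue_unique x z
  replace hu := hu.self_of_nhds
  set e := min δ ε with he
  have he0 : 0 < e := lt_min hδ hε
  have he1 : e ≤ δ := min_le_left _ _
  have he2 : e ≤ ε := min_le_right _ _
  have hzδ : z ∈ Ioo (z - δ) (z + δ) := ⟨by linarith, by linarith⟩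
  have honly : ∀ t, z - e < t → t < z + e → charFn x t = 0 → t = z := fun t h1 h2 h3 =>
    hu t ⟨by linarith, by linarith⟩ z hzδ h3 hz
  have hT1 : charFn x (z - e / 2) ≠ 0 := fun h => by
    have := honly _ (by linarith) (by linarith) h; linarith
  have hT2 : charFn x (z + e / 2) ≠ 0 := fun h => by
    have := honly _ (by linarith) (by linarith) h; linarith
  have hle1 : (eigenvalues x ∩ Iio (z - e / 2)).encard ≤ n := by
    rw [← hn]
    exact encard_le_encard (inter_subset_inter_right _ (Iio_subset_Iio (by linarith)))
  have hge2 : (n : ℕ∞) + 1 ≤ (eigenvalues x ∩ Iio (z + e / 2)).encard := by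
    rw [← hn]
    exact encard_add_one_le hz (by linarith)
  have hle2 : (n : ℕ∞) ≤ (eigenvalues x ∩ Iio (z - e / 2)).encard := by
    rw [← hn]
    refine encard_le_encard fun t ht => ⟨ht.1, ?_⟩
    by_contra hcon
    have h1 : t < z := ht.2
    have h2 : z - e / 2 ≤ t := not_lt.1 hcon
    have := honly t (by linarith) (by linarith) ht.1
    linarith
  filter_upwards [eventually_encard_eq hT1, eventually_encard_eq hT2] with y hy1 hy2
  obtain ⟨hzy, hny⟩ := nthEigenvalue_spec n y
  have hlt : ¬ ((n : ℕ∞) + 1 ≤ n) := not_le.2 (by exact_mod_cast Nat.lt_succ_self n)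
  rw [Real.dist_eq, abs_lt]
  constructor
  · by_contra hcon
    have h1 := encard_add_one_le (A := eigenvalues y) hzy (ν := z - e / 2) (by linarith)
    rw [hny, hy1] at h1
    exact hlt (h1.trans hle1)
  · by_contra hcon
    have h1 : (eigenvalues y ∩ Iio (z + e / 2)).encard ≤ n := by
      rw [← hny]
      exact encard_le_encard (inter_subset_inter_right _ (Iio_subset_Iio (by linarith)))
    rw [hy2] at h1
    exact hlt (hge2.trans h1)

end SturmLiouville

namespace SturmLiouville

/-! ### Differentiability of the eigenvalues -/

noncomputable section

open Filter Topology

/-- The `n`-th eigenfunction `u` of the problem `x`, normalized by `u(0) = 1`. -/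
def eigenfun (n : ℕ) (x : Params) : Cont := (leftSol x (nthEigenvalue n x)).1

lemma continuous_eigenfun (n : ℕ) : Continuous (eigenfun n) :=
  continuous_leftSol.fst.comp (f := fun x : Params => (x, nthEigenvalue n x))
    (continuous_id.prodMk (continuous_nthEigenvalue n))

/-- The divided difference of the `n`-th eigenvalue: it takes `y - x` to the difference of the
eigenvalues of `y` and `x`. On the diagonal it is the derivative of the eigenvalue, whose components
are, for the eigenfunction `u` with `∫ u² = 1`, the numbers `-u(0)²` and `u(1)²` and the function
`u²`. -/
def slopeForm (n : ℕ) (x y : Params) : Params →L[ℝ] ℝ :=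
  (pairing onePotential (eigenfun n x * eigenfun n y))⁻¹ •
    (((eigenfun n x).ext 1 * (eigenfun n y).ext 1) •
        (ContinuousLinearMap.fst ℝ ℝ Potential).comp (ContinuousLinearMap.snd ℝ ℝ (ℝ × Potential)) -
      ContinuousLinearMap.fst ℝ ℝ (ℝ × Potential) +
      (pairing.flip (eigenfun n x * eigenfun n y)).comp
        ((ContinuousLinearMap.snd ℝ ℝ Potential).comp
          (ContinuousLinearMap.snd ℝ ℝ (ℝ × Potential))))

lemma slopeForm_apply (n : ℕ) (x y d : Params) : slopeForm n x y d =
    (pairing onePotential (eigenfun n x * eigenfun n y))⁻¹ *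
      ((eigenfun n x).ext 1 * (eigenfun n y).ext 1 * d.2.1 - d.1 +
        pairing d.2.2 (eigenfun n x * eigenfun n y)) := rfl

lemma mass_eigenfun_pos (n : ℕ) (x : Params) :
    0 < pairing onePotential (eigenfun n x * eigenfun n x) := mass_pos _ _

lemma continuous_mass_eigenfun (n : ℕ) (x : Params) :
    Continuous fun y => pairing onePotential (eigenfun n x * eigenfun n y) := by
  have h : Continuous fun y => eigenfun n x * eigenfun n y :=
    continuous_const.mul (continuous_eigenfun n)
  exact (pairing onePotential).continuous.comp h

lemma continuousAt_slopeForm (n : ℕ) (x : Params) : ContinuousAt (slopeForm n x) x := by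
  have h : Continuous fun y => eigenfun n x * eigenfun n y :=
    continuous_const.mul (continuous_eigenfun n)
  unfold slopeForm
  refine ContinuousAt.smul ((continuous_mass_eigenfun n x).continuousAt.inv₀
    (mass_eigenfun_pos n x).ne') ?_
  refine Continuous.continuousAt ?_
  refine Continuous.add (Continuous.sub (Continuous.smul (continuous_const.mul
    (continuous_ext_one.comp (continuous_eigenfun n))) continuous_const) continuous_const) ?_
  exact (pairing.flip.continuous.comp h).clm_comp continuous_const

lemma nthEigenvalue_sub (n : ℕ) (x y : Params)
    (h : pairing onePotential (eigenfun n x * eigenfun n y) ≠ 0) :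
    nthEigenvalue n y - nthEigenvalue n x = slopeForm n x y (y - x) := by
  have hid := charFn_identity x y (nthEigenvalue n x) (nthEigenvalue n y)
  rw [(nthEigenvalue_spec n x).1, (nthEigenvalue_spec n y).1] at hid
  rw [slopeForm_apply, eq_inv_mul_iff_mul_eq₀ h]
  simp only [eigenfun, Prod.fst_sub, Prod.snd_sub] at hid ⊢
  linear_combination hid

lemma hasFDerivAt_nthEigenvalue (n : ℕ) (x : Params) :
    HasFDerivAt (nthEigenvalue n) (slopeForm n x x) x := by
  rw [hasFDerivAt_iff_isLittleO, Asymptotics.isLittleO_iff]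
  intro c hc
  have h1 : ∀ᶠ y in 𝓝 x, pairing onePotential (eigenfun n x * eigenfun n y) ≠ 0 :=
    ((continuous_mass_eigenfun n x).continuousAt (x := x)).eventually_ne (mass_eigenfun_pos n x).ne'
  have h2 := Metric.tendsto_nhds.1 (continuousAt_slopeForm n x) c hc
  filter_upwards [h1, h2] with y hy1 hy2
  rw [nthEigenvalue_sub n x y hy1, ← _root_.sub_apply]
  rw [dist_eq_norm] at hy2
  exact ((slopeForm n x y - slopeForm n x x).le_opNorm (y - x)).trans
    (mul_le_mul_of_nonneg_right hy2.le (norm_nonneg _))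

lemma norm_slopeForm_le (n : ℕ) {x : Params} {C : ℝ} (hx : x.BoundedBy C) :
    ‖slopeForm n x x‖ ≤ 3 * (2 + 8 * C) := by
  have hC := hx.1
  refine ContinuousLinearMap.opNorm_le_bound _ (by linarith) fun d => ?_
  have hS := mass_eigenfun_pos n x
  have hb : ‖eigenfun n x‖ ^ 2 ≤
      (2 + 8 * C) * pairing onePotential (eigenfun n x * eigenfun n x) :=
    sq_norm_leftSol_le hx (nthEigenvalue_spec n x).1
  have h0 : (eigenfun n x).ext 0 = 1 := leftSol_fst_zero _ _
  have h1 : 1 ≤ ‖eigenfun n x‖ ^ 2 := by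
    have := (eigenfun n x).abs_ext_le 0
    rw [h0, abs_one] at this
    nlinarith
  have h2 : |(eigenfun n x).ext 1 * (eigenfun n x).ext 1| ≤ ‖eigenfun n x‖ ^ 2 := by
    rw [abs_mul, ← sq]
    exact pow_le_pow_left₀ (abs_nonneg _) ((eigenfun n x).abs_ext_le 1) 2
  have h3 : ‖eigenfun n x * eigenfun n x‖ ≤ ‖eigenfun n x‖ ^ 2 :=
    (norm_mul_le _ _).trans (le_of_eq (sq _).symm)
  have d1 : |d.1| ≤ ‖d‖ := norm_fst_le d
  have d2 : |d.2.1| ≤ ‖d‖ := (norm_fst_le d.2).trans (norm_snd_le d)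
  have d3 : ‖d.2.2‖ ≤ ‖d‖ := (norm_snd_le d.2).trans (norm_snd_le d)
  have h4 : |(eigenfun n x).ext 1 * (eigenfun n x).ext 1 * d.2.1| ≤ ‖eigenfun n x‖ ^ 2 * ‖d‖ := by
    rw [abs_mul]
    exact mul_le_mul h2 d2 (abs_nonneg _) (sq_nonneg _)
  have h5 : |pairing d.2.2 (eigenfun n x * eigenfun n x)| ≤ ‖eigenfun n x‖ ^ 2 * ‖d‖ := by
    refine (abs_pairing_le _ _).trans ?_
    rw [mul_comm]
    exact mul_le_mul h3 d3 (norm_nonneg _) (sq_nonneg _)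
  have h6 : |d.1| ≤ ‖eigenfun n x‖ ^ 2 * ‖d‖ :=
    d1.trans (le_mul_of_one_le_left (norm_nonneg _) h1)
  rw [slopeForm_apply, Real.norm_eq_abs, abs_mul, abs_of_pos (inv_pos.2 hS), inv_mul_le_iff₀ hS]
  have h7 := abs_add_le ((eigenfun n x).ext 1 * (eigenfun n x).ext 1 * d.2.1 - d.1)
    (pairing d.2.2 (eigenfun n x * eigenfun n x))
  have h8 := abs_sub ((eigenfun n x).ext 1 * (eigenfun n x).ext 1 * d.2.1) d.1
  have h9 := mul_le_mul_of_nonneg_right hb (norm_nonneg d)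
  nlinarith

/-- The linear map taking a full problem `(h₀, h₁, h₂, q)` to its `i`-th subproblem. -/
def subproblem (i : Fin 2) : Problem →L[ℝ] Params :=
  ((EuclideanSpace.proj (0 : Fin 3)).comp
      (WithLp.fstL 2 ℝ (EuclideanSpace ℝ (Fin 3)) Potential)).prod
    (((EuclideanSpace.proj i.succ).comp (WithLp.fstL 2 ℝ (EuclideanSpace ℝ (Fin 3)) Potential)).prod
      (WithLp.sndL 2 ℝ (EuclideanSpace ℝ (Fin 3)) Potential))

lemma hasFDerivAt_eigenvalue (i : Fin 2) (n : ℕ) (p : Problem) :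
    HasFDerivAt (fun p : Problem => p.eigenvalue i n)
      ((slopeForm n (subproblem i p) (subproblem i p)).comp (subproblem i)) p :=
  (hasFDerivAt_nthEigenvalue n (subproblem i p)).comp p (subproblem i).hasFDerivAt

/-- The derivatives of all eigenvalues are bounded on every ball by one constant. -/
lemma exists_norm_fderiv_eigenvalue_le (R : ℝ) : ∃ D, 0 ≤ D ∧ ∀ (i : Fin 2) (n : ℕ),
    ∀ p ∈ Metric.ball (0 : Problem) R,
      ‖(slopeForm n (subproblem i p) (subproblem i p)).comp (subproblem i)‖ ≤ D := by
  set K := ‖subproblem 0‖ + ‖subproblem 1‖ with hK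
  have hK0 : 0 ≤ K := by positivity
  have hKi : ∀ i, ‖subproblem i‖ ≤ K := by
    intro i
    fin_cases i
    · exact le_add_of_nonneg_right (norm_nonneg _)
    · exact le_add_of_nonneg_left (norm_nonneg _)
  set C := 1 + 3 * (K * |R|) with hC
  have hC1 : 1 ≤ C := by rw [hC]; linarith [mul_nonneg hK0 (abs_nonneg R)]
  refine ⟨3 * (2 + 8 * C) * K, mul_nonneg (by linarith) hK0, fun i n p hp => ?_⟩
  have hp1 : ‖p‖ ≤ |R| := (mem_ball_zero_iff.1 hp).le.trans (le_abs_self R)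
  have hs : ‖subproblem i p‖ ≤ K * |R| :=
    ((subproblem i).le_opNorm p).trans (mul_le_mul (hKi i) hp1 (norm_nonneg _) hK0)
  have hb : (subproblem i p).BoundedBy C := by
    refine ⟨hC1, ?_⟩
    have d1 : |(subproblem i p).1| ≤ ‖subproblem i p‖ := norm_fst_le (subproblem i p)
    have d2 : |(subproblem i p).2.1| ≤ ‖subproblem i p‖ :=
      (norm_fst_le (subproblem i p).2).trans (norm_snd_le _)
    have d3 : ‖(subproblem i p).2.2‖ ≤ ‖subproblem i p‖ :=
      (norm_snd_le (subproblem i p).2).trans (norm_snd_le _)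
    linarith
  exact (ContinuousLinearMap.opNorm_comp_le _ _).trans
    (mul_le_mul (norm_slopeForm_le n hb) (hKi i) (norm_nonneg _) (by linarith))

end

end SturmLiouville

namespace SturmLiouville

/-! ### A biorthogonal system for the derivatives of the eigenvalues -/

/-- If `g'' = (q - ν) g` while `u` and `y` solve `u'' = (q - μ) u`, then `∫ g² (u y)'` is, up to
boundary terms, a multiple of the increment of the product of the Wronskians of `g` with `u`
and `y`. -/
lemma integral_sq_mul_deriv_mul {q : Potential} {μ ν : ℝ} {g g' u v y z : ℝ → ℝ}
    (hg : IsPair (shift q ν) g g') (hu : IsPair (shift q μ) u v) (hy : IsPair (shift q μ) y z) :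
    (ν - μ) * (2 * (∫ t in (0 : ℝ)..1, (u t * z t + v t * y t) * (g t * g t)) -
        (g 1 * g 1 * (u 1 * y 1) - g 0 * g 0 * (u 0 * y 0))) =
      (g 1 * v 1 - g' 1 * u 1) * (g 1 * z 1 - g' 1 * y 1) -
        (g 0 * v 0 - g' 0 * u 0) * (g 0 * z 0 - g' 0 * y 0) := by
  have hW := (hg.wronskian hu).mul (hg.wronskian hy)
  have hP := ((hg.fst.mul hg.fst).mul (hu.fst.mul hy.fst)).const_mul (ν - μ)
  have h := ((hW.add hP).congr_ae
    (g' := fun t => (2 * (ν - μ)) * ((u t * z t + v t * y t) * (g t * g t))) (by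
      filter_upwards [coeFn_shift q μ, coeFn_shift q ν] with t h1 h2
      rw [h1, h2]
      ring)).integral_eq
  rw [intervalIntegral.integral_const_mul] at h
  linear_combination h

/-- The case `g = u` of the preceding identity, in which the constant Wronskian of `u` and `y`
appears instead. -/
lemma integral_sq_mul_deriv_mul_self {w u v y z : ℝ → ℝ} (hu : IsPair w u v) (hy : IsPair w y z) :
    2 * (∫ t in (0 : ℝ)..1, (u t * z t + v t * y t) * (u t * u t)) -
        (u 1 * u 1 * (u 1 * y 1) - u 0 * u 0 * (u 0 * y 0)) =
      (u 1 * z 1 - v 1 * y 1) * ∫ t in (0 : ℝ)..1, u t * u t := by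
  have hW : ∀ t ∈ Icc (0 : ℝ) 1, u t * z t - v t * y t = u 1 * z 1 - v 1 * y 1 := by
    intro t ht
    have h := (hu.wronskian hy).sub_eq ht (y := 1) (by simp)
    simp only [sub_self, zero_mul, intervalIntegral.integral_zero] at h
    linarith
  have hP := (hu.fst.mul hu.fst).mul (hu.fst.mul hy.fst)
  have hcu : ContinuousOn u (uIcc 0 1) := by
    rw [uIcc_of_le zero_le_one]; exact hu.fst.continuousOn
  have hcv : ContinuousOn v (uIcc 0 1) := by
    rw [uIcc_of_le zero_le_one]; exact hu.snd.continuousOn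
  have hcy : ContinuousOn y (uIcc 0 1) := by
    rw [uIcc_of_le zero_le_one]; exact hy.fst.continuousOn
  have hcz : ContinuousOn z (uIcc 0 1) := by
    rw [uIcc_of_le zero_le_one]; exact hy.snd.continuousOn
  rw [← hP.integral_eq, ← intervalIntegral.integral_const_mul,
    ← intervalIntegral.integral_const_mul, ← intervalIntegral.integral_sub
      (ContinuousOn.intervalIntegrable (by fun_prop)) hP.integrable]
  refine intervalIntegral.integral_congr fun t ht => ?_
  rw [uIcc_of_le zero_le_one] at ht
  rw [← hW t ht]
  ring

lemma exists_isPair_at_one (w : Potential) (c d : ℝ) : ∃ Y Z : Cont,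
    IsPair w Y.ext Z.ext ∧ Y.ext 1 = c ∧ Z.ext 1 = d := by
  set U := (ivp w (1, 0)).1 with hU
  set V := (ivp w (1, 0)).2 with hV
  set S := (ivp w (0, 1)).1 with hS
  set T := (ivp w (0, 1)).2 with hT
  have h1 : IsPair w U.ext V.ext := isPair_ivp _ _
  have h2 : IsPair w S.ext T.ext := isPair_ivp _ _
  have hW := (h1.wronskian h2).integral_eq
  have e1 : U.ext 0 = 1 := ivp_fst_zero _ _
  have e2 : V.ext 0 = 0 := ivp_snd_zero _ _
  have e3 : S.ext 0 = 0 := ivp_fst_zero _ _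
  have e4 : T.ext 0 = 1 := ivp_snd_zero _ _
  simp only [sub_self, zero_mul, intervalIntegral.integral_zero, e1, e2, e3, e4, mul_one] at hW
  set α := c * T.ext 1 - d * S.ext 1 with hα
  set β := d * U.ext 1 - c * V.ext 1 with hβ
  refine ⟨α • U + β • S, α • V + β • T, h1.linear_comb h2 α β, ?_, ?_⟩
  · change α * U.ext 1 + β * S.ext 1 = c
    rw [hα, hβ]
    linear_combination -c * hW
  · change α * V.ext 1 + β * T.ext 1 = d
    rw [hα, hβ]
    linear_combination -d * hW

noncomputable section

/-- A continuous function, regarded as a potential. -/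
def Cont.toPotential (f : Cont) : Potential :=
  MemLp.toLp f.ext (MemLp.of_bound f.continuous_ext.aestronglyMeasurable ‖f‖
    (Filter.Eventually.of_forall f.abs_ext_le))

lemma pairing_toPotential (f h : Cont) :
    pairing f.toPotential h = ∫ t in (0 : ℝ)..1, f.ext t * h.ext t := by
  rw [pairing_apply]
  refine intervalIntegral.integral_congr_ae_restrict ?_
  rw [uIoc_of_le zero_le_one]
  have : (f.toPotential : ℝ → ℝ) =ᵐ[(volume : Measure ℝ).restrict (Icc (0 : ℝ) 1)] f.ext :=
    MemLp.coeFn_toLp _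
  filter_upwards [ae_restrict_of_ae_restrict_of_subset Ioc_subset_Icc_self this] with t ht
  rw [ht]

lemma leftSol_ext_one_ne_zero {x : Params} {μ : ℝ} (h : charFn x μ = 0) :
    (leftSol x μ).1.ext 1 ≠ 0 := by
  intro h0
  have hp := isPair_leftSol x μ
  have h1 : (leftSol x μ).2.ext 1 = 0 := by rw [charFn, h0] at h; linarith
  have h2 : IsPair (shift x.2.2 μ) (ivp (shift x.2.2 μ) (0, 1)).1.ext
    (ivp (shift x.2.2 μ) (0, 1)).2.ext := isPair_ivp _ _
  have hW := (hp.wronskian h2).integral_eq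
  rw [h0, h1, ivp_fst_zero, ivp_snd_zero, leftSol_fst_zero] at hW
  simp at hW

/-- The derivatives of the eigenvalues of the two subproblems of `q` admit a biorthogonal system.
The vector dual to the eigenvalue `μ` with eigenfunction `u` of the `j`-th subproblem has the
potential `(u y)'`, where `y` solves the same equation and satisfies the boundary condition at `1`
of the other subproblem. -/
lemma exists_biorthogonal {q : Problem} (hne : q.right 0 ≠ q.right 1) (j : Fin 2) (m : ℕ) :
    ∃ T : Problem, ∀ (i : Fin 2) (n : ℕ),
      (slopeForm n (subproblem i q) (subproblem i q) (subproblem i T) = 0 ↔ (i, n) ≠ (j, m)) := by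
  have hne' : ∀ i, i ≠ j → q.right i ≠ q.right j := by
    intro i hij
    fin_cases i <;> fin_cases j <;> simp_all [Ne.symm hne]
  have hother : ∀ i, i ≠ j → i = 1 - j := by
    intro i hij
    fin_cases i <;> fin_cases j <;> simp_all
  have hj : 1 - j ≠ j := by fin_cases j <;> simp
  set μ := nthEigenvalue m (subproblem j q) with hμ
  have hμ0 : charFn (subproblem j q) μ = 0 := (nthEigenvalue_spec m _).1
  set U := (leftSol (subproblem j q) μ).1 with hU
  set V := (leftSol (subproblem j q) μ).2 with hV
  have hp : IsPair (shift q.potential μ) U.ext V.ext := isPair_leftSol (subproblem j q) μ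
  have hU0 : U.ext 0 = 1 := leftSol_fst_zero _ _
  have hV0 : V.ext 0 = -q.left := leftSol_snd_zero _ _
  have hU1 : U.ext 1 ≠ 0 := leftSol_ext_one_ne_zero hμ0
  have hV1 : V.ext 1 = -(q.right j * U.ext 1) := by
    have : q.right j * U.ext 1 + V.ext 1 = 0 := hμ0
    linarith
  obtain ⟨Y, Z, hyz, hY1, hZ1⟩ := exists_isPair_at_one (shift q.potential μ) 1 (-q.right (1 - j))
  set T : Problem := WithLp.toLp 2 (WithLp.toLp 2 ![-(U.ext 0 * Y.ext 0) / 2,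
    -(U.ext 1 * Y.ext 1) / 2, -(U.ext 1 * Y.ext 1) / 2], (U * Z + V * Y).toPotential) with hT
  have hTl : T.left = -(U.ext 0 * Y.ext 0) / 2 := rfl
  have hTr : ∀ i, T.right i = -(U.ext 1 * Y.ext 1) / 2 := by
    intro i; fin_cases i <;> rfl
  have hTq : T.potential = (U * Z + V * Y).toPotential := rfl
  refine ⟨T, fun i n => ?_⟩
  set ν := nthEigenvalue n (subproblem i q) with hν
  have hν0 : charFn (subproblem i q) ν = 0 := (nthEigenvalue_spec n _).1
  set g := eigenfun n (subproblem i q) with hg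
  set g' := (leftSol (subproblem i q) ν).2 with hg'
  have hgp : IsPair (shift q.potential ν) g.ext g'.ext := isPair_leftSol (subproblem i q) ν
  have hg0 : g.ext 0 = 1 := leftSol_fst_zero _ _
  have hg'0 : g'.ext 0 = -q.left := leftSol_snd_zero _ _
  have hg'1 : g'.ext 1 = -(q.right i * g.ext 1) := by
    have : q.right i * g.ext 1 + g'.ext 1 = 0 := hν0
    linarith
  have hS := mass_eigenfun_pos n (subproblem i q)
  have hform : 2 * (g.ext 1 * g.ext 1 * T.right i - T.left + pairing T.potential (g * g)) =
      2 * (∫ t in (0 : ℝ)..1, (U.ext t * Z.ext t + V.ext t * Y.ext t) * (g.ext t * g.ext t)) -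
        (g.ext 1 * g.ext 1 * (U.ext 1 * Y.ext 1) - g.ext 0 * g.ext 0 * (U.ext 0 * Y.ext 0)) := by
    rw [hTl, hTr, hTq, pairing_toPotential, hg0]
    change 2 * (_ + ∫ t in (0 : ℝ)..1,
      (U.ext t * Z.ext t + V.ext t * Y.ext t) * (g.ext t * g.ext t)) = _
    ring
  have hiff : slopeForm n (subproblem i q) (subproblem i q) (subproblem i T) = 0 ↔
      2 * (g.ext 1 * g.ext 1 * T.right i - T.left + pairing T.potential (g * g)) = 0 := by
    rw [slopeForm_apply, mul_eq_zero, inv_eq_zero, mul_eq_zero]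
    simp only [hS.ne', false_or, OfNat.ofNat_ne_zero]
    rfl
  rw [hiff, hform]
  by_cases hkk : (i, n) = (j, m)
  · -- On the diagonal the pairing is the nonzero Wronskian of `u` and `y`, times `∫ u²`.
    obtain ⟨rfl, rfl⟩ := Prod.mk.injEq .. ▸ hkk
    have h := integral_sq_mul_deriv_mul_self hp hyz
    have hgU : g = U := rfl
    refine iff_of_false ?_ (not_not.2 rfl)
    rw [hgU, h, hV1, hY1, hZ1]
    have h2 : ∫ t in (0 : ℝ)..1, U.ext t * U.ext t = pairing onePotential (g * g) :=
      (pairing_one (U * U)).symm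
    rw [h2]
    refine mul_ne_zero ?_ hS.ne'
    have h3 : U.ext 1 * -q.right (1 - i) - -(q.right i * U.ext 1) * 1 =
        U.ext 1 * (q.right i - q.right (1 - i)) := by ring
    rw [h3]
    exact mul_ne_zero hU1 (sub_ne_zero.2 (hne' _ hj).symm)
  · -- Off the diagonal one of the two Wronskians vanishes at `1`, and the first one also at `0`.
    refine iff_of_true ?_ hkk
    have hνμ : ν - μ ≠ 0 := by
      refine sub_ne_zero.2 fun heq => ?_
      by_cases hij : i = j
      · subst hij
        exact hkk (by rw [nthEigenvalue_injective _ heq])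
      · rw [heq] at hν0
        have h1 : q.right i * U.ext 1 + V.ext 1 = 0 := hν0
        have h2 : (q.right i - q.right j) * U.ext 1 = 0 := by rw [hV1] at h1; linarith
        exact (mul_ne_zero (sub_ne_zero.2 (hne' i hij)) hU1) h2
    have h := integral_sq_mul_deriv_mul hgp hp hyz
    refine (mul_eq_zero.1 (h.trans ?_)).resolve_left hνμ
    rw [hU0, hV0, hg0, hg'0, hV1, hg'1, hY1, hZ1]
    by_cases hij : i = j
    · subst hij; ring
    · rw [hother i hij]; ring

end

end SturmLiouville

namespace SturmLiouville

/-! ### The least squares functional -/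

noncomputable section

/-- The derivative of a summand of the least squares functional. -/
def residualDeriv (ω : Fin 2 × ℕ → ℝ) (Q p : Problem) (k : Fin 2 × ℕ) : Problem →L[ℝ] ℝ :=
  (ω k * (2 * (p.eigenvalue k.1 k.2 - Q.eigenvalue k.1 k.2))) •
    (slopeForm k.2 (subproblem k.1 p) (subproblem k.1 p)).comp (subproblem k.1)

lemma hasFDerivAt_residual (ω : Fin 2 × ℕ → ℝ) (Q p : Problem) (k : Fin 2 × ℕ) :
    HasFDerivAt (fun p => residual ω Q p k) (residualDeriv ω Q p k) p := by
  have h := (((hasFDerivAt_eigenvalue k.1 k.2 p).sub_const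
    (Q.eigenvalue k.1 k.2)).pow 2).const_mul (ω k)
  convert! h using 1
  rw [residualDeriv, mul_smul]
  congr 2
  norm_num

/-- On a ball containing the target, the summands and their derivatives are bounded by multiples of
the weights. -/
lemma exists_residual_bound (ω : Fin 2 × ℕ → ℝ) {R : ℝ} {Q : Problem}
    (hQ : Q ∈ Metric.ball (0 : Problem) R) : ∃ B : ℝ, ∀ k, 0 ≤ ω k →
      ∀ p ∈ Metric.ball (0 : Problem) R,
        residual ω Q p k ≤ ω k * B ∧ ‖residualDeriv ω Q p k‖ ≤ ω k * B := by
  obtain ⟨D, hD0, hD⟩ := exists_norm_fderiv_eigenvalue_le R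
  have hdiff : ∀ (k : Fin 2 × ℕ), ∀ p ∈ Metric.ball (0 : Problem) R,
      |p.eigenvalue k.1 k.2 - Q.eigenvalue k.1 k.2| ≤ D * (2 * R) := by
    intro k p hp
    have h := (convex_ball (0 : Problem) R).norm_image_sub_le_of_norm_hasFDerivWithin_le
      (f := fun p : Problem => p.eigenvalue k.1 k.2)
      (fun y _ => (hasFDerivAt_eigenvalue k.1 k.2 y).hasFDerivWithinAt)
      (fun y hy => hD k.1 k.2 y hy) hQ hp
    refine h.trans (mul_le_mul_of_nonneg_left ?_ hD0)
    have h1 := mem_ball_zero_iff.1 hp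
    have h2 := mem_ball_zero_iff.1 hQ
    linarith [norm_sub_le p Q]
  have hR : 0 ≤ R := (norm_nonneg Q).trans (mem_ball_zero_iff.1 hQ).le
  refine ⟨(D * (2 * R)) ^ 2 + 2 * (D * (2 * R)) * D, fun k hk p hp => ⟨?_, ?_⟩⟩
  · refine mul_le_mul_of_nonneg_left ?_ hk
    have h1 : (p.eigenvalue k.1 k.2 - Q.eigenvalue k.1 k.2) ^ 2 ≤ (D * (2 * R)) ^ 2 := by
      rw [← sq_abs]
      exact pow_le_pow_left₀ (abs_nonneg _) (hdiff k p hp) 2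
    have h2 : 0 ≤ 2 * (D * (2 * R)) * D := by positivity
    linarith
  · rw [residualDeriv, norm_smul, Real.norm_eq_abs, abs_mul, abs_mul, abs_of_nonneg hk, abs_two,
      mul_assoc]
    refine mul_le_mul_of_nonneg_left ?_ hk
    have h1 : 2 * |p.eigenvalue k.1 k.2 - Q.eigenvalue k.1 k.2| *
        ‖(slopeForm k.2 (subproblem k.1 p) (subproblem k.1 p)).comp (subproblem k.1)‖ ≤
        2 * (D * (2 * R)) * D :=
      mul_le_mul (mul_le_mul_of_nonneg_left (hdiff k p hp) zero_le_two) (hD k.1 k.2 p hp)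
        (norm_nonneg _) (by positivity)
    have h2 : 0 ≤ (D * (2 * R)) ^ 2 := sq_nonneg _
    linarith

section

variable {I : Set (Fin 2 × ℕ)} {ω : Fin 2 × ℕ → ℝ}

lemma residual_nonneg (hω : ∀ k ∈ I, 0 < ω k) (Q p : Problem) (k : I) :
    0 ≤ residual ω Q p k :=
  mul_nonneg (hω k k.2).le (sq_nonneg _)

lemma summable_residual (hω : ∀ k ∈ I, 0 < ω k) (hs : Summable fun k : I => ω k)
    (Q p : Problem) : Summable fun k : I => residual ω Q p k := by
  have hQ : Q ∈ Metric.ball (0 : Problem) (‖Q‖ + ‖p‖ + 1) := by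
    rw [mem_ball_zero_iff]; linarith [norm_nonneg p]
  have hp : p ∈ Metric.ball (0 : Problem) (‖Q‖ + ‖p‖ + 1) := by
    rw [mem_ball_zero_iff]; linarith [norm_nonneg Q]
  obtain ⟨B, hB⟩ := exists_residual_bound ω hQ
  exact Summable.of_nonneg_of_le (residual_nonneg hω Q p)
    (fun k => (hB k (hω k k.2).le p hp).1) (hs.mul_right B)

lemma summable_residualDeriv_and_hasFDerivAt_G (hω : ∀ k ∈ I, 0 < ω k)
    (hs : Summable fun k : I => ω k) (Q p : Problem) :
    Summable (fun k : I => residualDeriv ω Q p k) ∧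
      HasFDerivAt (G I ω Q) (∑' k : I, residualDeriv ω Q p k) p := by
  have hQ : Q ∈ Metric.ball (0 : Problem) (‖Q‖ + ‖p‖ + 1) := by
    rw [mem_ball_zero_iff]; linarith [norm_nonneg p]
  have hp : p ∈ Metric.ball (0 : Problem) (‖Q‖ + ‖p‖ + 1) := by
    rw [mem_ball_zero_iff]; linarith [norm_nonneg Q]
  obtain ⟨B, hB⟩ := exists_residual_bound ω hQ
  refine ⟨Summable.of_norm_bounded (hs.mul_right B)
    fun k => (hB k (hω k k.2).le p hp).2, ?_⟩
  exact hasFDerivAt_tsum_of_isPreconnected (hs.mul_right B) Metric.isOpen_ball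
    (convex_ball _ _).isPreconnected (fun k y _ => hasFDerivAt_residual ω Q y k)
    (fun k y hy => (hB k (hω k k.2).le y hy).2) hQ (summable_residual hω hs Q Q) hp

lemma G_nonneg (hω : ∀ k ∈ I, 0 < ω k) (Q p : Problem) : 0 ≤ G I ω Q p :=
  tsum_nonneg (residual_nonneg hω Q p)

/-- Testing the derivative of `G` against the biorthogonal system isolates each residual. -/
lemma G_eq_zero_of_fderiv_eq_zero (hω : ∀ k ∈ I, 0 < ω k) (hs : Summable fun k : I => ω k)
    {Q q : Problem} (hne : q.right 0 ≠ q.right 1) (h : fderiv ℝ (G I ω Q) q = 0) :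
    G I ω Q q = 0 := by
  obtain ⟨hsum, hd⟩ := summable_residualDeriv_and_hasFDerivAt_G hω hs Q q
  rw [hd.fderiv] at h
  have key : ∀ k : I, residual ω Q q k = 0 := by
    intro k
    obtain ⟨T, hT⟩ := exists_biorthogonal hne (k : Fin 2 × ℕ).1 (k : Fin 2 × ℕ).2
    have h1 : ∑' l : I, residualDeriv ω Q q l T = 0 := by
      have h2 := (ContinuousLinearMap.apply ℝ ℝ T).map_tsum hsum
      rw [h, map_zero] at h2
      exact h2.symm
    rw [tsum_eq_single k fun l hl => ?_] at h1
    · have h3 : slopeForm (k : Fin 2 × ℕ).2 (subproblem (k : Fin 2 × ℕ).1 q)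
          (subproblem (k : Fin 2 × ℕ).1 q) (subproblem (k : Fin 2 × ℕ).1 T) ≠ 0 :=
        fun h0 => (hT _ _).1 h0 rfl
      have h4 := (mul_eq_zero.1 h1).resolve_right h3
      have h5 := (mul_eq_zero.1 h4).resolve_left (hω k k.2).ne'
      have h6 := (mul_eq_zero.1 h5).resolve_left two_ne_zero
      rw [residual, h6]
      ring
    · have h3 := (hT (l : Fin 2 × ℕ).1 (l : Fin 2 × ℕ).2).2 fun he => hl (Subtype.ext he)
      exact mul_eq_zero_of_right _ h3
  exact (tsum_congr key).trans tsum_zero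

end

end

end SturmLiouville

theorem theorem2p1
    (I : Set (Fin 2 × ℕ)) (ω : Fin 2 × ℕ → ℝ) (hω : ∀ k ∈ I, 0 < ω k)
    (hI : I.Finite ∨ Summable (fun k : I => ω k))
    (Q q : SturmLiouville.Problem)
    (hne : SturmLiouville.Problem.right q 0 ≠ SturmLiouville.Problem.right q 1) :
    (∀ p : SturmLiouville.Problem, Summable (fun k : I => SturmLiouville.residual ω Q p k)) ∧
    DifferentiableAt ℝ (SturmLiouville.G I ω Q) q ∧
    (∇ (SturmLiouville.G I ω Q) q = 0 ↔ SturmLiouville.G I ω Q q = 0) ∧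
    (0 < SturmLiouville.G I ω Q q → ¬ IsLocalMin (SturmLiouville.G I ω Q) q) := by
  have hs : Summable (fun k : I => ω k) := by
    rcases hI with hI | hI
    · have := hI.to_subtype
      exact .of_finite
    · exact hI
  have hgrad : ∇ (SturmLiouville.G I ω Q) q = 0 ↔ fderiv ℝ (SturmLiouville.G I ω Q) q = 0 :=
    (InnerProductSpace.toDual ℝ SturmLiouville.Problem).symm.map_eq_zero_iff
  have hmin : IsLocalMin (SturmLiouville.G I ω Q) q → SturmLiouville.G I ω Q q = 0 := fun h =>
    SturmLiouville.G_eq_zero_of_fderiv_eq_zero hω hs hne h.fderiv_eq_zero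
  refine ⟨SturmLiouville.summable_residual hω hs Q,
    (SturmLiouville.summable_residualDeriv_and_hasFDerivAt_G hω hs Q q).2.differentiableAt,
    ⟨fun h => SturmLiouville.G_eq_zero_of_fderiv_eq_zero hω hs hne (hgrad.1 h), fun h => ?_⟩,
    fun hpos h => hpos.ne' (hmin h)⟩
  refine hgrad.2 (IsLocalMin.fderiv_eq_zero (Filter.Eventually.of_forall fun p => ?_))
  rw [h]
  exact SturmLiouville.G_nonneg hω Q p
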